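/- Let $X$ be a real or complex Banach space, let $n\ge 0$ and let $A_1,\dots,A_n$ be (possibly unbounded) operators in $X$, among which exactly the distinct operators $B_1,\dots,B_i$ occur, $B_j$ with multiplicity $S_j\ge 1$, $\sum_j S_j=n$ (the $A_m$ may be listed in any order). Assume (A0) each $B_j$ generates a $C_0$-semigroup $(T_{B_j}(t))_{t\ge 0}$ on $X$, and $T_{B_j}(t)T_{B_k}(s)=T_{B_k}(s)T_{B_j}(t)$ for all $j,k$ and all $s,t\ge 0$; (A1)$'$ $B_j-B_k$, with domain $D(B_j)\cap D(B_k)$, is injective for $j\ne k$. Notation. For $N\ge 0$ let $D_N\subseteq X$ be the common domain of all $N$-fold products of operators from $\{B_1,\dots,B_i\}$ ($D_0=X$). Index vectors of $X^n$ on the coefficient side by pairs $(j,k)$ with $1\le j\le i$, $0\le k<S_j$. Let $M_n=[(B_1)_{S_1}\ \cdots\ (B_i)_{S_i}]$ be the $n\times n$ operator matrix whose entry in row $r\in\{0,\dots,n-1\}$ and column $(j,k)$ is $\binom{r}{k}B_j^{\,r-k}$ (and $0$ if $k>r$), regarded as an operator from $X^n$ to $X^n$ on its natural domain. A solution of $$\prod_{m=1}^n\Big(\frac{d}{dt}-A_m\Big)u=0,\qquad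 u^{(k)}(0)=x_k\quad(0\le k\le n-1)\tag{1}$$ is a function $u\in C^n([0,\infty);X)$ with these initial values for which there are functions $v_0=u,v_1,\dots,v_n=0$ on $[0,\infty)$ such that, for $0\le m<n$, $v_m$ is differentiable with values in $D(A_{m+1})$ and $v_{m+1}=v_m'-A_{m+1}v_m$. Say that the data $\vec x=(x_0,\dots,x_{n-1})$ satisfy (A2)$'$ (the ranges of the differences $B_j-B_l$ are large enough for $\vec x$) if $x_r\in D_{n-1-r}$ for $0\le r\le n-1$ and, for all $j$, all $0\le k<S_j$ and all integers $m_l\ge0$ $(l\ne j)$ with $\sum_{l\ne j}m_l\le k$, $$z_{j,k}\in\prod_{l\ne j}(B_j-B_l)^{S_l+m_l}\,(D_n),$$ where $z_{j,k}$ is the value at $t=0$ of $\big(\frac{d}{dt}-B_j\big)^k\prod_{l\neq j}\big(\frac{d}{dt}-B_l\big)^{S_l}u$, expressed through $u^{(r)}(0)=x_r$. Theorem. (i) $M_n$ is injective, so that $M_n^{-1}$ is a well-defined operator on the range of $M_n$. (ii) If $\vec x$ satisfies (A2)$'$, then $\vec x=M_n\vec y$ for some $\vec y$ with all components in $D_n$.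 (iii) For every $\vec x$ of the form $M_n\vec y$ with all components of $\vec y$ in $D_n$ (in particular, by (ii), whenever (A2)$'$ holds), the problem (1) has exactly one solution on $[0,\infty)$, namely $$u(t)=\sum_{j=1}^{i}\sum_{k=0}^{S_j-1}\frac{t^k}{k!}\,T_{B_j}(t)\,y_{j,k},\qquad \vec y=M_n^{-1}\vec x .$$ -/

import Mathlib

noncomputable section

namespace DAlembert

open Filter Topology

section Operators

variable {𝕜 X : Type*} [Field 𝕜] [AddCommGroup X] [Module 𝕜 X]

/-- The product `f g` of two unbounded operators, on its natural domain
`{x ∈ D(g) | g x ∈ D(f)}`. -/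
def prodOp (f g : X →ₗ.[𝕜] X) : X →ₗ.[𝕜] X where
  domain := (f.domain.comap g.toFun).map g.domain.subtype
  toFun :=
    { toFun := fun x => f ⟨g ⟨x, by
          obtain ⟨x, y, hy, rfl⟩ := x; exact y.2⟩, by
          obtain ⟨x, y, hy, rfl⟩ := x; exact hy⟩
      map_add' := by
        intro x y
        rw [← LinearPMap.map_add]
        congr 1
        apply Subtype.ext
        simp only [Submodule.coe_add]
        rw [← LinearPMap.map_add]
        rfl
      map_smul' := by
        intro c x
        simp only [RingHom.id_apply]
        rw [← LinearPMap.map_smul]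
        congr 1
        apply Subtype.ext
        simp only [Submodule.coe_smul]
        rw [← LinearPMap.map_smul]
        rfl }

theorem mem_graph_prodOp {f g : X →ₗ.[𝕜] X} {x z : X} :
    (x, z) ∈ (prodOp f g).graph ↔ ∃ y, (x, y) ∈ g.graph ∧ (y, z) ∈ f.graph := by
  simp only [LinearPMap.mem_graph_iff]
  constructor
  · rintro ⟨⟨_, a, ha, rfl⟩, rfl, rfl⟩
    exact ⟨g a, ⟨a, rfl, rfl⟩, ⟨g a, ha⟩, rfl, rfl⟩
  · rintro ⟨y, ⟨a, rfl, rfl⟩, b, hb, rfl⟩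
    refine ⟨⟨a, a, ?_, rfl⟩, rfl, ?_⟩
    · show g a ∈ f.domain
      rw [← hb]; exact b.2
    · show f _ = f _
      congr 1
      exact Subtype.ext hb.symm

/-- The identity operator, everywhere defined. -/
def idOp : X →ₗ.[𝕜] X := (LinearMap.id : X →ₗ[𝕜] X).toPMap ⊤

/-- The product `L₁ L₂ ⋯ L_r` of a list of operators, on its natural domain. -/
def listProd (L : List (X →ₗ.[𝕜] X)) : X →ₗ.[𝕜] X := L.foldr prodOp idOp

/-- The power `B ^ p`, on its natural domain; `B ^ 0` is the identity on the whole space. -/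
def powOp (B : X →ₗ.[𝕜] X) (p : ℕ) : X →ₗ.[𝕜] X := listProd (List.replicate p B)

/-- A finite matrix `(E r c)` of unbounded operators, as an operator from `X ^ C` to `X ^ R`, on its
natural domain: `(E y) r = ∑ c, E r c (y c)` whenever all terms are defined. -/
def matrixOp {R C : Type*} [Fintype C] (E : R → C → X →ₗ.[𝕜] X) : (C → X) →ₗ.[𝕜] (R → X) where
  domain := ⨅ r, ⨅ c, (E r c).domain.comap (LinearMap.proj c)
  toFun :=
    { toFun := fun y r => ∑ c, E r c ⟨y.1 c, by
          have h := y.2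
          simp only [Submodule.mem_iInf] at h
          exact h r c⟩
      map_add' := by
        intro x y
        funext r
        simp only [Pi.add_apply]
        rw [← Finset.sum_add_distrib]
        refine Finset.sum_congr rfl fun c _ => ?_
        rw [← LinearPMap.map_add]
        rfl
      map_smul' := by
        intro a x
        funext r
        simp only [RingHom.id_apply, Pi.smul_apply]
        rw [Finset.smul_sum]
        refine Finset.sum_congr rfl fun c _ => ?_
        rw [← LinearPMap.map_smul]
        rfl }

/-- The number of indices `m` with `σ m = j`: the multiplicity `S_j` of `B_j` in the family
`A_m = B_{σ m}`. -/
def mult {n i : ℕ} (σ : Fin n → Fin i) (j : Fin i) : ℕ :=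
  (Finset.univ.filter fun m => σ m = j).card

/-- The index set of the `S_1 + ⋯ + S_i = n` coefficients: pairs `(j, k)` with `0 ≤ k < S_j`. -/
abbrev Coeff {n i : ℕ} (σ : Fin n → Fin i) : Type := (j : Fin i) × Fin (mult σ j)

/-- The operator matrix `M_n = [(B_1)_{S_1} ⋯ (B_i)_{S_i}]`: the entry in row `r` and in column `k`
of block `j` is `C(r, k) B_j ^ (r - k)`, which is zero for `k > r`. -/
def matrixM {n i : ℕ} (σ : Fin n → Fin i) (B : Fin i → X →ₗ.[𝕜] X) :
    (Coeff σ → X) →ₗ.[𝕜] (Fin n → X) :=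
  matrixOp fun (r : Fin n) (c : Coeff σ) =>
    (Nat.choose (r : ℕ) (c.2 : ℕ) : 𝕜) • powOp (B c.1) ((r : ℕ) - (c.2 : ℕ))

/-- The common domain of all products of `N` (equivalently, of at most `N`) operators from the
family `B`. -/
def commonDomain {i : ℕ} (B : Fin i → X →ₗ.[𝕜] X) : ℕ → Set X
  | 0 => Set.univ
  | N + 1 => {x | ∀ j, ∃ y ∈ commonDomain B N, (x, y) ∈ (B j).graph}

/-- For a list `L = [L₁, …, L_r]` of operators, `IsInitialValue L x z` says that `z` is the value
at `t = 0` of `(d/dt - L₁) ⋯ (d/dt - L_r) u`, computed from the derivatives `x k = u^{(k)}(0)`.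
The value of `(d/dt - L₁) v` at `0` is `v'(0) - L₁ v(0)`, and `v'(0)` is obtained from the derivatives
of `u'`, that is, from the shifted sequence. -/
def IsInitialValue : List (X →ₗ.[𝕜] X) → (ℕ → X) → X → Prop
  | [], x, z => z = x 0
  | A :: L, x, z => ∃ v v', IsInitialValue L x v ∧ IsInitialValue L (fun k => x (k + 1)) v' ∧
      (v, v' - z) ∈ A.graph

/-- Extension of a finite sequence by zero. -/
def extend {n : ℕ} (x : Fin n → X) (k : ℕ) : X := if h : k < n then x ⟨k, h⟩ else 0

/-- The ranges of the differences `B_j - B_l` are large enough for the initial data `x`: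
the data have the regularity needed to write down, for all `j` and all `0 ≤ k < S_j`, the initial
value `z_{j,k}` of `(d/dt - B_j)^k ∏_{l ≠ j} (d/dt - B_l)^{S_l} u`, and each `z_{j,k}` lies in the range
of `∏_{l ≠ j} (B_j - B_l)^{S_l + m_l}` restricted to the common domain of the `n`-fold products, for
all exponents `m_l ≥ 0` with `∑_{l ≠ j} m_l ≤ k`. -/
def RangeLargeEnough {n i : ℕ} (σ : Fin n → Fin i) (B : Fin i → X →ₗ.[𝕜] X) (x : Fin n → X) : Prop :=
  (∀ r : Fin n, x r ∈ commonDomain B (n - 1 - (r : ℕ))) ∧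
  ∀ (j : Fin i) (k : ℕ), k < mult σ j →
    ∃ z, IsInitialValue
        ((List.finRange i).flatMap fun l => List.replicate (if l = j then k else mult σ l) (B l))
        (extend x) z ∧
      ∀ m : Fin i → ℕ, ∑ l ∈ Finset.univ.erase j, m l ≤ k →
        ∃ w ∈ commonDomain B n,
          (w, z) ∈ (listProd ((List.finRange i).flatMap fun l =>
            List.replicate (if l = j then 0 else mult σ l + m l) (B j - B l))).graph

end Operators

section Evolution

variable {𝕜 X : Type*} [RCLike 𝕜] [NormedAddCommGroup X] [NormedSpace 𝕜 X] [NormedSpace ℝ X]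

/-- `(T t)_{t ≥ 0}` is a strongly continuous semigroup of bounded operators. Only the values of `T`
at nonnegative times matter. -/
structure IsC0Semigroup (T : ℝ → X →L[𝕜] X) : Prop where
  zero : T 0 = 1
  add : ∀ s t, 0 ≤ s → 0 ≤ t → T (s + t) = (T s).comp (T t)
  tendsto : ∀ x, Tendsto (fun t => T t x) (𝓝[>] 0) (𝓝 x)

/-- `A` is the infinitesimal generator of `T`: `x ∈ D(A)` with `A x = y` if and only if
`(T t x - x) / t` tends to `y` as `t` decreases to `0`. -/
def IsGenerator (A : X →ₗ.[𝕜] X) (T : ℝ → X →L[𝕜] X) : Prop :=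
  ∀ x y, (x, y) ∈ A.graph ↔ Tendsto (fun t : ℝ => t⁻¹ • (T t x - x)) (𝓝[>] 0) (𝓝 y)

/-- `u` is a (classical) solution on `[0, ∞)` of `∏_{m} (d/dt - A_m) u = 0`, `u^{(k)}(0) = x_k`:
`u` is `n` times continuously differentiable, and there are functions `v_0 = u, v_1, …, v_n = 0` on
`[0, ∞)` such that `v_m` is differentiable with values in the domain of the operator `A` with index
`m`, and `v_{m+1} = (d/dt - A) v_m` for this operator. -/
structure IsSolution {n : ℕ} (A : Fin n → X →ₗ.[𝕜] X) (x : Fin n → X) (u : ℝ → X) : Prop where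
  smooth : ContDiffOn ℝ n u (Set.Ici 0)
  initial : ∀ k : Fin n, iteratedDerivWithin k u (Set.Ici 0) 0 = x k
  equation : ∃ v : Fin (n + 1) → ℝ → X, (∀ t, 0 ≤ t → v 0 t = u t) ∧
    (∀ (m : Fin n) (t : ℝ), 0 ≤ t → ∃ a, (v m.castSucc t, a) ∈ (A m).graph ∧
      HasDerivWithinAt (v m.castSucc) (a + v m.succ t) (Set.Ici 0) t) ∧
    ∀ t, 0 ≤ t → v (Fin.last n) t = 0

/-- `t ↦ ∑_j ∑_{k < S_j} (t ^ k / k!) T_{B_j}(t) y_{j,k}`. -/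
def dAlembert {n i : ℕ} (σ : Fin n → Fin i) (T : Fin i → ℝ → X →L[𝕜] X) (y : Coeff σ → X) (t : ℝ) :
    X :=
  ∑ j, ∑ k : Fin (mult σ j), (t ^ (k : ℕ) / (Nat.factorial k : ℝ)) • T j t (y ⟨j, k⟩)

end Evolution

end DAlembert

end

noncomputable section

namespace DAlembert

/-! ### C₀-semigroups: local bounds, orbits, uniqueness for the first-order Cauchy problem -/

section Semigroup

open Filter Topology Set

variable {𝕜 X : Type*} [RCLike 𝕜] [NormedAddCommGroup X] [NormedSpace 𝕜 X]
  {T : ℝ → X →L[𝕜] X} {A : X →ₗ.[𝕜] X}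

/-! The unbounded operators are turned into elements of a commutative ring, where the theorem
becomes a statement about a confluent Vandermonde system.

Each generator has a bounded resolvent `ρ j = (c j - B j)⁻¹`, and the resolvents commute because the
semigroups do. The commutative algebra they generate acts on `X`. By injectivity of the resolvents
and of the differences, the elements `ρ j` and `ρ j ρ l (B j - B l)` act injectively, so `X` embeds
into its localisation at them. There `B j` is multiplication by `b j = c j - (ρ j)⁻¹`, and `b j - b
l` is a unit for `j ≠ l` (`IsModel`, `exists_isModel`).

On the coefficients of `∑ (t ^ k / k!) T_j(t) (y j k)`, the operator `d/dt` acts in block `j` as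
shift plus `b j`. Hence `p(d/dt) u` at `0` is `∑ j, (p(X + b j) y j)(0)`, with `X` the shift, and
row `r` of the matrix is the case `p = X ^ r`. For `p = (X - b j) ^ k ∏_{l ≠ j} (X - b l) ^ S l`
only block `j` survives, on which `∏_{l ≠ j} (X + b j - b l) ^ S l` acts. This is coprime to `X ^ S
j`, which gives injectivity. Conversely, inverting it factor by factor on the values `z_{j,k}` uses
exactly the divisibility in the range condition; as these `p` span the polynomials of degree `< n`,
the resulting `y` also satisfies the rows `X ^ r`.

The formula solves the equation because in block `j` the full product of the `d/dt - A m` contains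
the factor `X ^ S j`, which kills `y j`. For uniqueness, take a solution with zero data and its
chain `v m`. After smoothing by resolvents every `v m` is seen to vanish at `0`; then `v m' = A v m`
and `v m (0) = 0` give `v m = 0`, from the last index down (`IsSolution.eq_zero`). -/

theorem IsC0Semigroup.continuousWithinAt_zero (hT : IsC0Semigroup T) (x : X) :
    ContinuousWithinAt (fun t => T t x) (Ici 0) 0 := by
  rw [← continuousWithinAt_Ioi_iff_Ici]
  have h := hT.tendsto x
  simpa [ContinuousWithinAt, hT.zero] using h

theorem IsC0Semigroup.apply_add (hT : IsC0Semigroup T) {s t : ℝ} (hs : 0 ≤ s) (ht : 0 ≤ t) (x : X) :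
    T (s + t) x = T s (T t x) := by
  rw [hT.add s t hs ht]; rfl

section Complete

variable [CompleteSpace X]

/-- Otherwise there are `s n → 0` with `‖T (s n)‖` unbounded, although every `T (s n) x` converges,
against Banach–Steinhaus. -/
theorem IsC0Semigroup.exists_norm_le_near_zero (hT : IsC0Semigroup T) :
    ∃ δ > 0, ∃ M : ℝ, 1 ≤ M ∧ ∀ s ∈ Icc 0 δ, ‖T s‖ ≤ M := by
  by_contra! H
  have H' : ∀ n : ℕ, ∃ s ∈ Icc (0 : ℝ) (1 / ((n : ℝ) + 1)), (n : ℝ) + 1 < ‖T s‖ := fun n =>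
    H _ (by positivity) _ (by linarith [n.cast_nonneg (α := ℝ)])
  choose s hs hs' using H'
  have hlim : Tendsto s atTop (𝓝[≥] 0) := by
    refine tendsto_nhdsWithin_iff.2 ⟨?_, .of_forall fun n => (hs n).1⟩
    exact squeeze_zero (fun n => (hs n).1) (fun n => (hs n).2) tendsto_one_div_add_atTop_nhds_zero_nat
  obtain ⟨C, hC⟩ := banach_steinhaus (g := fun n => T (s n)) fun x => by
    have h := ((hT.continuousWithinAt_zero x).tendsto.comp hlim).norm.bddAbove_range
    obtain ⟨C, hC⟩ := h
    exact ⟨C, fun n => hC ⟨n, rfl⟩⟩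
  obtain ⟨n, hn⟩ := exists_nat_gt C
  linarith [hs' n, hC n]

theorem IsC0Semigroup.exists_norm_le (hT : IsC0Semigroup T) (a : ℝ) :
    ∃ M : ℝ, 0 ≤ M ∧ ∀ s ∈ Icc 0 a, ‖T s‖ ≤ M := by
  obtain ⟨δ, hδ, M, hM, h⟩ := hT.exists_norm_le_near_zero
  have key : ∀ N : ℕ, ∀ s ∈ Icc (0 : ℝ) (N * δ), ‖T s‖ ≤ M ^ (N + 1) := by
    intro N
    induction N with
    | zero =>
      intro s hs
      simpa using h s ⟨hs.1, hs.2.trans (by simpa using hδ.le)⟩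
    | succ N ih =>
      intro s hs
      rcases le_total s δ with hsδ | hsδ
      · exact (h s ⟨hs.1, hsδ⟩).trans (le_self_pow₀ hM (by simp))
      · have h1 : s = δ + (s - δ) := by ring
        have h2 : T s = (T δ).comp (T (s - δ)) := by
          rw [← hT.add _ _ hδ.le (by linarith), ← h1]
        rw [h2, pow_succ']
        refine (ContinuousLinearMap.opNorm_comp_le _ _).trans ?_
        refine mul_le_mul (h _ ⟨hδ.le, le_rfl⟩) (ih _ ⟨by linarith, ?_⟩) (norm_nonneg _) (by linarith)
        have := hs.2
        push_cast at this
        linarith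
  obtain ⟨N, hN⟩ := exists_nat_ge (a / δ)
  refine ⟨M ^ (N + 1), by positivity, fun s hs => key N s ⟨hs.1, hs.2.trans ?_⟩⟩
  rwa [div_le_iff₀ hδ] at hN

theorem IsC0Semigroup.continuousOn (hT : IsC0Semigroup T) (x : X) :
    ContinuousOn (fun t => T t x) (Ici 0) := by
  intro t ht
  obtain ⟨M, hM0, hM⟩ := hT.exists_norm_le (t + 1)
  -- Factoring out `T` at the smaller of the two times reduces continuity from either side to
  -- continuity at `0`.
  have hbound : ∀ s ∈ Icc 0 (t + 1), ‖T s x - T t x‖ ≤ M * ‖T |s - t| x - x‖ := by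
    intro s hs
    rcases le_total s t with hst | hst
    · have h1 : T t x = T s (T |s - t| x) := by
        rw [← hT.apply_add hs.1 (abs_nonneg _), abs_of_nonpos (by linarith)]; congr 2; ring
      rw [h1, ← map_sub, ← norm_neg, ← map_neg, neg_sub]
      exact (T s).le_of_opNorm_le (hM s hs) _
    · have h1 : T s x = T t (T |s - t| x) := by
        rw [← hT.apply_add ht (abs_nonneg _), abs_of_nonneg (by linarith)]; congr 2; ring
      rw [h1, ← map_sub]
      exact (T t).le_of_opNorm_le (hM t ⟨ht, by linarith⟩) _
  have hlim : Tendsto (fun s : ℝ => |s - t|) (𝓝[Ici 0] t) (𝓝[≥] 0) := by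
    refine tendsto_nhdsWithin_iff.2 ⟨?_, .of_forall fun s => abs_nonneg (s - t)⟩
    have : Tendsto (fun s : ℝ => |s - t|) (𝓝 t) (𝓝 |t - t|) :=
      (continuous_abs.comp (continuous_id.sub continuous_const)).tendsto t
    rw [sub_self, abs_zero] at this
    exact this.mono_left inf_le_left
  have h0 : Tendsto (fun s => M * ‖T |s - t| x - x‖) (𝓝[Ici 0] t) (𝓝 0) := by
    have := ((hT.continuousWithinAt_zero x).tendsto.comp hlim)
    have := ((this.sub_const x).norm).const_mul M
    simpa [hT.zero] using this
  refine tendsto_iff_norm_sub_tendsto_zero.2 (squeeze_zero' (.of_forall fun _ => norm_nonneg _) ?_ h0)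
  filter_upwards [self_mem_nhdsWithin, mem_nhdsWithin_of_mem_nhds (Iic_mem_nhds (lt_add_one t))]
    with s hs hs'
  exact hbound s ⟨hs, hs'⟩

theorem IsC0Semigroup.continuous_max (hT : IsC0Semigroup T) (x : X) :
    Continuous fun t => T (max t 0) x :=
  (hT.continuousOn x).comp_continuous (continuous_id.max continuous_const) fun t => mem_Ici.2 (le_max_right t 0)

end Complete

variable [NormedSpace ℝ X] [IsScalarTower ℝ 𝕜 X]

theorem IsGenerator.hasDerivWithinAt_right (hA : IsGenerator A T) (hT : IsC0Semigroup T) {x y : X}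
    (h : (x, y) ∈ A.graph) {t : ℝ} (ht : 0 ≤ t) :
    HasDerivWithinAt (fun s => T s x) (T t y) (Ici t) t := by
  rw [← hasDerivWithinAt_Ioi_iff_Ici, hasDerivWithinAt_iff_tendsto_slope' (by simp)]
  have h1 := (hA x y).1 h
  have h2 : Tendsto (fun s => s - t) (𝓝[>] t) (𝓝[>] 0) := by
    refine tendsto_nhdsWithin_iff.2 ⟨?_, ?_⟩
    · have : Tendsto (fun s : ℝ => s - t) (𝓝 t) (𝓝 (t - t)) :=
        (continuous_id.sub continuous_const).tendsto t
      rw [sub_self] at this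
      exact this.mono_left inf_le_left
    · filter_upwards [self_mem_nhdsWithin] with s hs
      simpa using hs
  have h3 := ((T t).continuous.tendsto y).comp (h1.comp h2)
  refine h3.congr' ?_
  filter_upwards [self_mem_nhdsWithin] with s hs
  have hs' : 0 ≤ s - t := by simpa using le_of_lt hs
  have h4 : T s x = T t (T (s - t) x) := by rw [← hT.apply_add ht hs']; congr 2; ring
  simp [slope, h4, ContinuousLinearMap.map_smul_of_tower]

theorem IsGenerator.graph_map (hA : IsGenerator A T) {S : X →L[𝕜] X}
    (hS : ∀ t, 0 ≤ t → S.comp (T t) = (T t).comp S) {x y : X} (h : (x, y) ∈ A.graph) :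
    (S x, S y) ∈ A.graph := by
  rw [hA] at h ⊢
  refine ((S.continuous.tendsto y).comp h).congr' ?_
  filter_upwards [self_mem_nhdsWithin] with t ht
  have := congrArg (fun F => F x) (hS t (le_of_lt ht))
  simp only [ContinuousLinearMap.comp_apply] at this
  simp [ContinuousLinearMap.map_smul_of_tower, this]

variable [CompleteSpace X]

/-- The generator only controls right derivatives. Two continuous functions with equal right
derivatives and equal initial values agree, and the integral is differentiable from both sides. The
`max s 0` makes the integrand continuous on the whole line. -/
theorem IsGenerator.orbit_sub_eq_integral (hA : IsGenerator A T) (hT : IsC0Semigroup T) {x y : X}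
    (h : (x, y) ∈ A.graph) {t : ℝ} (ht : 0 ≤ t) :
    T t x = x + ∫ s in (0 : ℝ)..t, T (max s 0) y := by
  have hg := hT.continuous_max y
  refine eq_of_has_deriv_right_eq (a := 0) (b := t) (f := fun t => T t x)
    (g := fun t => x + ∫ s in (0 : ℝ)..t, T (max s 0) y) (f' := fun t => T (max t 0) y)
    ?_ ?_ ?_ ?_ ?_ t ⟨ht, le_rfl⟩
  · intro s hs
    have := hA.hasDerivWithinAt_right hT h hs.1
    simpa [hs.1] using this
  · intro s _
    exact ((intervalIntegral.integral_hasDerivAt_right (hg.intervalIntegrable _ _)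
      (hg.stronglyMeasurableAtFilter _ _) hg.continuousAt).const_add x).hasDerivWithinAt
  · exact (hT.continuousOn x).mono fun s hs => hs.1
  · exact (continuous_const.add (intervalIntegral.continuous_primitive
      (fun a b => hg.intervalIntegrable a b) 0)).continuousOn
  · simp [hT.zero]

theorem IsGenerator.hasDerivWithinAt (hA : IsGenerator A T) (hT : IsC0Semigroup T) {x y : X}
    (h : (x, y) ∈ A.graph) {t : ℝ} (ht : 0 ≤ t) :
    HasDerivWithinAt (fun s => T s x) (T t y) (Ici 0) t := by
  have hg := hT.continuous_max y
  have h1 := ((intervalIntegral.integral_hasDerivAt_right (a := 0) (b := t)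
    (hg.intervalIntegrable _ _)
    (hg.stronglyMeasurableAtFilter _ _) hg.continuousAt).const_add x).hasDerivWithinAt (s := Ici 0)
  rw [max_eq_left ht] at h1
  exact h1.congr (fun s hs => hA.orbit_sub_eq_integral hT h hs) (hA.orbit_sub_eq_integral hT h ht)

/-- The function `s ↦ T (t - s) (v s)` has right derivative zero, so its values `T t (v 0)` at `0`
and `v t` at `t` coincide. -/
theorem IsGenerator.eq_zero_of_hasDerivWithinAt (hA : IsGenerator A T) (hT : IsC0Semigroup T)
    {v : ℝ → X} (h0 : v 0 = 0)
    (hv : ∀ t, 0 ≤ t → ∃ a, (v t, a) ∈ A.graph ∧ HasDerivWithinAt v a (Ici 0) t) {t : ℝ}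
    (ht : 0 ≤ t) : v t = 0 := by
  obtain ⟨M, hM0, hM⟩ := hT.exists_norm_le t
  have hvc : ContinuousOn v (Ici 0) := fun s hs => (hv s hs).choose_spec.2.continuousWithinAt
  have hconst := constant_of_has_deriv_right_zero (f := fun s => T (t - s) (v s)) (a := 0) (b := t)
    ?_ ?_ t ⟨ht, le_rfl⟩
  · simpa [hT.zero, h0] using hconst
  · intro s hs
    have hlim : Tendsto (fun s' => M * ‖v s' - v s‖ + ‖T (t - s') (v s) - T (t - s) (v s)‖)
        (𝓝[Icc 0 t] s) (𝓝 0) := by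
      have h1 : Tendsto v (𝓝[Icc 0 t] s) (𝓝 (v s)) :=
        (hvc s hs.1).mono (fun r hr => hr.1)
      have h2 : ContinuousOn (fun s' => T (t - s') (v s)) (Icc 0 t) :=
        (hT.continuousOn (v s)).comp (by fun_prop) fun r hr => sub_nonneg.2 hr.2
      have h3 : Tendsto (fun s' => T (t - s') (v s)) (𝓝[Icc 0 t] s) (𝓝 (T (t - s) (v s))) := h2 s hs
      simpa using ((h1.sub_const (v s)).norm.const_mul M).add
        ((h3.sub_const (T (t - s) (v s))).norm)
    refine tendsto_iff_norm_sub_tendsto_zero.2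
      (squeeze_zero' (.of_forall fun _ => norm_nonneg _) ?_ hlim)
    filter_upwards [self_mem_nhdsWithin] with r hr
    have : T (t - r) (v r) - T (t - s) (v s)
        = T (t - r) (v r - v s) + (T (t - r) (v s) - T (t - s) (v s)) := by
      rw [map_sub]; abel
    rw [this]
    refine (norm_add_le _ _).trans (add_le_add_left ?_ _)
    exact (T (t - r)).le_of_opNorm_le (hM _ ⟨sub_nonneg.2 hr.2, by linarith [hr.1]⟩) _
  · intro s hs
    obtain ⟨a, ha, hd⟩ := hv s hs.1
    rw [← hasDerivWithinAt_Ioi_iff_Ici, hasDerivWithinAt_iff_tendsto_slope' (by simp)]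
    have hd1 : Tendsto (slope v s) (𝓝[>] s) (𝓝 a) :=
      (hasDerivWithinAt_iff_tendsto_slope' (by simp)).1
        (hd.mono fun r hr => hs.1.trans (le_of_lt hr))
    have h2 : Tendsto (fun r => r - s) (𝓝[>] s) (𝓝[>] 0) := by
      refine tendsto_nhdsWithin_iff.2 ⟨?_, ?_⟩
      · have : Tendsto (fun r : ℝ => r - s) (𝓝 s) (𝓝 (s - s)) :=
          (continuous_id.sub continuous_const).tendsto s
        rw [sub_self] at this
        exact this.mono_left inf_le_left
      · filter_upwards [self_mem_nhdsWithin] with r hr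
        simpa using hr
    have hd2 := ((hA _ _).1 ha).comp h2
    have hd3 := ((hd1.sub hd2).norm).const_mul M
    rw [sub_self, norm_zero, mul_zero] at hd3
    refine squeeze_zero_norm' ?_ hd3
    filter_upwards [self_mem_nhdsWithin, mem_nhdsWithin_of_mem_nhds (Iic_mem_nhds hs.2)] with r hr hr'
    have hr : s < r := hr
    have hr' : r ≤ t := hr'
    have h4 : T (t - s) (v s) = T (t - r) (T (r - s) (v s)) := by
      rw [← hT.apply_add (by linarith) (by linarith)]; congr 2; ring
    -- The slope is a uniformly bounded operator applied to the difference of two slopes, both of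
    -- which tend to `a`.
    have h5 : slope (fun s => T (t - s) (v s)) s r
        = T (t - r) (slope v s r - (r - s)⁻¹ • (T (r - s) (v s) - v s)) := by
      simp only [slope, vsub_eq_sub, h4, ← smul_sub, ContinuousLinearMap.map_smul_of_tower, map_sub]
      congr 1
      abel
    rw [h5]
    exact (T (t - r)).le_of_opNorm_le (hM _ ⟨by linarith, by linarith [hs.1]⟩) _

end Semigroup

/-! ### The resolvent of a generator -/

section Resolvent

open Filter Topology Set

variable {𝕜 X : Type*} [RCLike 𝕜] [NormedAddCommGroup X] [NormedSpace 𝕜 X] [NormedSpace ℝ X]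
  [CompleteSpace X] {T : ℝ → X →L[𝕜] X} {A : X →ₗ.[𝕜] X}

theorem IsC0Semigroup.continuous_exp_smul (hT : IsC0Semigroup T) (c : ℝ) (x : X) :
    Continuous fun s : ℝ => Real.exp (-c * s) • T (max s 0) x :=
  (by fun_prop : Continuous fun s : ℝ => Real.exp (-c * s)).smul (hT.continuous_max x)

variable [IsScalarTower ℝ 𝕜 X]

/-- The truncated Laplace transform of a semigroup over `[0, 1]`. -/
theorem IsC0Semigroup.exists_truncatedLaplace (hT : IsC0Semigroup T) (c : ℝ) :
    ∃ K : X →L[𝕜] X, ∀ x, K x = ∫ s in (0 : ℝ)..1, Real.exp (-c * s) • T (max s 0) x := by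
  obtain ⟨M, hM0, hM⟩ := hT.exists_norm_le 1
  have : SMulCommClass ℝ 𝕜 X := IsScalarTower.to_smulCommClass
  have hint := fun x => (hT.continuous_exp_smul c x).intervalIntegrable (μ := MeasureTheory.volume) 0 1
  let K : X →ₗ[𝕜] X :=
    { toFun := fun x => ∫ s in (0 : ℝ)..1, Real.exp (-c * s) • T (max s 0) x
      map_add' := fun x y => by
        rw [← intervalIntegral.integral_add (hint x) (hint y)]
        simp
      map_smul' := fun a x => by
        rw [RingHom.id_apply, ← intervalIntegral.integral_smul]
        simp [smul_comm a] }
  refine ⟨K.mkContinuous (Real.exp |c| * M) fun x => ?_, fun x => rfl⟩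
  have := intervalIntegral.norm_integral_le_of_norm_le_const (a := 0) (b := 1)
    (f := fun s : ℝ => Real.exp (-c * s) • T (max s 0) x) (C := Real.exp |c| * M * ‖x‖) ?_
  · rw [sub_zero, abs_one, mul_one] at this
    exact this
  · intro s hs
    rw [uIoc_of_le zero_le_one] at hs
    rw [norm_smul, mul_assoc, Real.norm_eq_abs, Real.abs_exp, max_eq_left hs.1.le]
    refine mul_le_mul (Real.exp_le_exp.2 ?_) ((T s).le_of_opNorm_le (hM s ⟨hs.1.le, hs.2⟩) x)
      (norm_nonneg _) (Real.exp_nonneg _)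
    calc -c * s ≤ |c| * s := mul_le_mul_of_nonneg_right (neg_le_abs c) hs.1.le
      _ ≤ |c| := mul_le_of_le_one_right (abs_nonneg c) hs.2

/-- The fundamental theorem of calculus for `e^{-cs} T s x` on `[0, 1]`. Truncating at `1` avoids
any growth bound for the semigroup, at the price of the term `e^{-c} T 1`. -/
theorem IsGenerator.truncatedLaplace_of_mem (hA : IsGenerator A T) (hT : IsC0Semigroup T) {c : ℝ}
    {K : X →L[𝕜] X} (hK : ∀ x, K x = ∫ s in (0 : ℝ)..1, Real.exp (-c * s) • T (max s 0) x)
    {x y : X} (h : (x, y) ∈ A.graph) :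
    K (c • x - y) = x - Real.exp (-c) • T 1 x := by
  have hint := fun x => (hT.continuous_exp_smul c x).intervalIntegrable (μ := MeasureTheory.volume) 0 1
  have hd : ∀ s ∈ Ioo (0 : ℝ) 1, HasDerivAt (fun s => Real.exp (-c * s) • T s x)
      (Real.exp (-c * s) • T (max s 0) (y - c • x)) s := by
    intro s hs
    have h1 : HasDerivAt (fun s => T s x) (T s y) s :=
      (hA.hasDerivWithinAt hT h hs.1.le).hasDerivAt (Ici_mem_nhds hs.1)
    have h2 : HasDerivAt (fun s : ℝ => Real.exp (-c * s)) (Real.exp (-c * s) * -c) s := by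
      simpa using ((hasDerivAt_id s).const_mul (-c)).exp
    refine (h2.smul h1).congr_deriv ?_
    rw [max_eq_left hs.1.le, map_sub, ContinuousLinearMap.map_smul_of_tower, smul_sub, smul_smul]
    simp [sub_eq_add_neg]
  have h3 := intervalIntegral.integral_eq_sub_of_hasDerivAt_of_le zero_le_one
    (f := fun s => Real.exp (-c * s) • T s x) ?_ hd (hint _)
  · rw [← hK] at h3
    rw [← neg_sub y, map_neg, h3]
    simp [hT.zero]
  · exact (by fun_prop : Continuous fun s : ℝ => Real.exp (-c * s)).continuousOn.smul
      ((hT.continuousOn x).mono fun s hs => hs.1)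

theorem IsGenerator.truncatedLaplace_mem (hA : IsGenerator A T) (hT : IsC0Semigroup T) {c : ℝ}
    {K : X →L[𝕜] X} (hK : ∀ x, K x = ∫ s in (0 : ℝ)..1, Real.exp (-c * s) • T (max s 0) x) (x : X) :
    (K x, c • K x - (x - Real.exp (-c) • T 1 x)) ∈ A.graph := by
  rw [hA]
  set g : ℝ → X := fun s => Real.exp (-c * s) • T (max s 0) x with hg
  have hgc : Continuous g := hT.continuous_exp_smul c x
  have hi : ∀ a b, IntervalIntegrable g MeasureTheory.volume a b :=
    fun a b => hgc.intervalIntegrable a b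
  -- Applying `T h` only translates the interval of integration, so the derivative at `h = 0` comes
  -- from the endpoints and from the factor `e^{ch}`.
  have key : ∀ h, 0 ≤ h → T h (K x) = Real.exp (c * h) • ∫ s in (0 + h)..(1 + h), g s := by
    intro h hh
    rw [hK, ← intervalIntegral.integral_comp_add_right, ← intervalIntegral.integral_smul,
      ← ContinuousLinearMap.intervalIntegral_comp_comm _ (hi 0 1)]
    refine intervalIntegral.integral_congr fun s hs => ?_
    rw [uIcc_of_le zero_le_one] at hs
    simp only [hg]
    rw [ContinuousLinearMap.map_smul_of_tower, max_eq_left hs.1, max_eq_left (add_nonneg hs.1 hh),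
      add_comm s h, hT.apply_add hh hs.1, smul_smul, ← Real.exp_add]
    congr 2
    ring
  have hF : ∀ a : ℝ, HasDerivAt (fun h : ℝ => ∫ s in (0 : ℝ)..(a + h), g s) (g a) 0 := by
    intro a
    have h1 : HasDerivAt (fun t => ∫ s in (0 : ℝ)..t, g s) (g (a + 0)) (a + 0) :=
      intervalIntegral.integral_hasDerivAt_right (hi _ _) (hgc.stronglyMeasurableAtFilter _ _)
        hgc.continuousAt
    have := h1.comp_const_add a 0
    simpa using this
  have hE : HasDerivAt (fun h : ℝ => Real.exp (c * h)) c 0 := by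
    simpa using ((hasDerivAt_id (0 : ℝ)).const_mul c).exp
  have hd := hE.smul ((hF 1).sub (hF 0))
  have hd' : HasDerivWithinAt (fun h => T h (K x)) (c • K x - (x - Real.exp (-c) • T 1 x)) (Ici 0) 0 := by
    refine (hd.hasDerivWithinAt (s := Ici 0)).congr_of_mem ?_ (by simp) |>.congr_deriv ?_
    · intro h hh
      rw [key h hh]
      simp only [Pi.smul_apply', Pi.sub_apply]
      rw [intervalIntegral.integral_interval_sub_left (hi _ _) (hi _ _)]
    · simp only [Pi.sub_apply, add_zero, intervalIntegral.integral_same, sub_zero, hK, mul_zero,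
        Real.exp_zero, one_smul]
      simp only [hg]
      simp [hT.zero]
      abel
  have := (hasDerivWithinAt_iff_tendsto_slope' (by simp)).1 (hd'.mono Ioi_subset_Ici_self)
  refine this.congr fun h => ?_
  simp [slope, hT.zero]

/-- The resolvent of the generator at a large real point. -/
theorem IsGenerator.exists_resolvent (hA : IsGenerator A T) (hT : IsC0Semigroup T) :
    ∃ (c : ℝ) (ρ : X →L[𝕜] X), ∀ x y, (x, y) ∈ A.graph ↔ ρ (c • x - y) = x := by
  -- With this `c`, `1 - e^{-c} T 1` is invertible by the Neumann series; `K` composed with its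
  -- inverse `V` is the resolvent.
  obtain ⟨c, hc⟩ : ∃ c : ℝ, ‖T 1‖ < Real.exp c := by
    obtain ⟨c, hc⟩ := exists_gt ‖T 1‖
    exact ⟨c, hc.trans (by linarith [Real.add_one_le_exp c])⟩
  obtain ⟨K, hK⟩ := hT.exists_truncatedLaplace c
  set E : X →L[𝕜] X := (Real.exp (-c) : 𝕜) • T 1 with hE
  have hEx : ∀ x, E x = Real.exp (-c) • T 1 x := fun x => by
    rw [hE, smul_apply, ← RCLike.real_smul_eq_coe_smul (K := 𝕜)]
  have hE1 : ‖E‖ < 1 := by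
    rw [hE, norm_smul, RCLike.norm_ofReal, Real.abs_exp, Real.exp_neg, inv_mul_lt_iff₀ (Real.exp_pos c)]
    simpa using hc
  obtain ⟨U, hU⟩ := isUnit_one_sub_of_norm_lt_one hE1
  have hU' : ∀ x, (U : X →L[𝕜] X) x = x - Real.exp (-c) • T 1 x := fun x => by simp [hU, hEx]
  obtain ⟨V, hV⟩ : ∃ V : X →L[𝕜] X, V = ((U⁻¹ : (X →L[𝕜] X)ˣ) : X →L[𝕜] X) := ⟨_, rfl⟩
  have hUi : ∀ x, (U : X →L[𝕜] X) (V x) = x := fun x => by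
    rw [hV, ← mul_apply_eq_comp, Units.mul_inv]; rfl
  have hiU : ∀ x, V ((U : X →L[𝕜] X) x) = x := fun x => by
    rw [hV, ← mul_apply_eq_comp, Units.inv_mul]; rfl
  have hmem : ∀ w, (K (V w), c • K (V w) - w) ∈ A.graph := by
    intro w
    have := hA.truncatedLaplace_mem hT hK (V w)
    rwa [← hU', hUi] at this
  refine ⟨c, K.comp V, fun x y => ⟨fun h => ?_, fun h => ?_⟩⟩
  · have h1 := hmem (c • x - y)
    have h3 := A.graph.sub_mem h1 h
    have h4 := hA.truncatedLaplace_of_mem hT hK h3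
    have h5 : c • (K (V (c • x - y)) - x)
      - (c • K (V (c • x - y)) - (c • x - y) - y) = 0 := by
      rw [smul_sub]; abel
    simp only at h4
    rw [h5, map_zero, ← hU'] at h4
    have h6 := hiU (K (V (c • x - y)) - x)
    rw [← h4, map_zero] at h6
    exact (sub_eq_zero.1 h6.symm)
  · have := hmem (c • x - y)
    simp only [ContinuousLinearMap.comp_apply] at h
    rw [h] at this
    simpa using this

end Resolvent

/-! ### Embedding into a localisation where the operators become ring elements -/

/-- The operators `B j` are realised, through the embedding `ι`, as multiplication by elements `b j` of
a commutative ring, the differences of which are units. -/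
structure IsModel {J 𝕜 X R V : Type*} [Field 𝕜] [AddCommGroup X] [Module 𝕜 X] [CommRing R]
    [AddCommGroup V] [Module R V] (B : J → X →ₗ.[𝕜] X) (ι : X →+ V) (b : J → R) : Prop where
  injective : Function.Injective ι
  mem_graph_iff : ∀ j x y, (x, y) ∈ (B j).graph ↔ b j • ι x = ι y
  isUnit_sub : ∀ j l, j ≠ l → IsUnit (b j - b l)

universe u

theorem LocalizedModule.mkLinearMap_injective {A X : Type*} [CommRing A] [AddCommGroup X]
    [Module A X] {S : Submonoid A} (hS : ∀ s ∈ S, ∀ x : X, s • x = 0 → x = 0) :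
    Function.Injective (LocalizedModule.mkLinearMap S X) := by
  rw [injective_iff_map_eq_zero]
  intro x hx
  obtain ⟨s, hs⟩ := (IsLocalizedModule.eq_zero_iff S (LocalizedModule.mkLinearMap S X)).1 hx
  exact hS s s.2 x hs

/-- Since `B j = c j - (ρ j)⁻¹` formally, it suffices to invert the `ρ j` and the differences. The
embedding remains injective because everything inverted acts injectively on `X`. -/
theorem exists_isModel_of_resolvents {J 𝕜 : Type*} {A X : Type u} [Field 𝕜] [AddCommGroup X]
    [Module 𝕜 X] [CommRing A] [Module A X] {B : J → X →ₗ.[𝕜] X} {ρ c : J → A}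
    (hρ : ∀ j x y, (x, y) ∈ (B j).graph ↔ ρ j • (c j • x - y) = x)
    (hB : ∀ j l, j ≠ l → ∀ x y, (x, y) ∈ (B j).graph → (x, y) ∈ (B l).graph → x = 0) :
    ∃ (R V : Type u) (_ : CommRing R) (_ : AddCommGroup V) (_ : Module R V) (ι : X →+ V) (b : J → R),
      IsModel B ι b := by
  have hρ0 : ∀ (j) (w : X), ρ j • w = 0 → w = 0 := by
    intro j w hw
    have h1 : ((0 : X), -w) ∈ (B j).graph := by
      rw [hρ]; simpa using hw
    simpa using (B j).graph_fst_eq_zero_snd h1 rfl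
  -- Formally `δ j l = ρ j ρ l (B j - B l)`, cleared of inverses.
  let δ : J → J → A := fun j l => ρ j * ρ l * (c j - c l) - ρ l + ρ j
  have hδ : ∀ j l, j ≠ l → ∀ x : X, δ j l • x = 0 → x = 0 := by
    -- If `δ j l` kills `x`, then `B j` and `B l` take the same value at `ρ j ρ l x`, so this vector
    -- vanishes.
    intro j l hjl x hx
    have h1 : ((ρ j * ρ l) • x, c j • (ρ j * ρ l) • x - ρ l • x) ∈ (B j).graph := by
      rw [hρ, sub_sub_cancel, mul_smul]
    have h2 : ((ρ j * ρ l) • x, c l • (ρ j * ρ l) • x - ρ j • x) ∈ (B l).graph := by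
      rw [hρ, sub_sub_cancel, mul_comm, mul_smul]
    have h3 : c j • (ρ j * ρ l) • x - ρ l • x = c l • (ρ j * ρ l) • x - ρ j • x := by
      rw [← sub_eq_zero, ← hx]
      simp only [δ, smul_smul, ← sub_smul]
      congr 1
      ring
    rw [← h3] at h2
    have h4 := hB j l hjl _ _ h1 h2
    rw [mul_smul] at h4
    exact hρ0 _ _ (hρ0 _ _ h4)
  let S : Submonoid A := Submonoid.closure (Set.range ρ ∪ {a | ∃ j l, j ≠ l ∧ a = δ j l})
  have hS : ∀ s ∈ S, ∀ x : X, s • x = 0 → x = 0 := by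
    intro s hs
    induction hs using Submonoid.closure_induction with
    | mem s hs =>
      rcases hs with ⟨j, rfl⟩ | ⟨j, l, hjl, rfl⟩
      · exact hρ0 j
      · exact hδ j l hjl
    | one => intro x hx; simpa using hx
    | mul s t _ _ h1 h2 =>
      intro x hx
      rw [mul_smul] at hx
      exact h2 _ (h1 _ hx)
  let R := Localization S
  let f : A →+* R := algebraMap A R
  have hu : ∀ j, IsUnit (f (ρ j)) := fun j =>
    IsLocalization.map_units R (⟨ρ j, Submonoid.subset_closure (.inl ⟨j, rfl⟩)⟩ : S)
  choose U hU using hu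
  let ι := LocalizedModule.mkLinearMap S X
  have hι : ∀ (a : A) (x : X), f a • ι x = ι (a • x) := fun a x => by
    rw [map_smul, algebraMap_smul]
  have hinj : Function.Injective ι := LocalizedModule.mkLinearMap_injective hS
  refine ⟨R, LocalizedModule S X, inferInstance, inferInstance, inferInstance, ι.toAddMonoidHom,
    fun j => f (c j) - ↑(U j)⁻¹, hinj, fun j x y => ?_, fun j l hjl => ?_⟩
  · rw [hρ]
    have h1 : (f (c j) - ↑(U j)⁻¹) • ι x = ι y ↔
        (U j : R) • ((f (c j) - ↑(U j)⁻¹) • ι x) = (U j : R) • ι y := by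
      constructor
      · intro h; rw [h]
      · intro h
        have := congrArg (fun v => (↑(U j)⁻¹ : R) • v) h
        simpa [smul_smul] using this
    refine Iff.trans ?_ h1.symm
    rw [smul_smul, mul_sub, Units.mul_inv, sub_smul, one_smul, hU, ← map_mul, hι, hι,
      sub_eq_iff_eq_add, ← map_add, hinj.eq_iff, smul_sub, sub_eq_iff_eq_add, mul_smul, add_comm]
  · have h1 : ((U j : R) * U l) * ((f (c j) - ↑(U j)⁻¹) - (f (c l) - ↑(U l)⁻¹)) = f (δ j l) := by
      have e1 := (U j).mul_inv
      have e2 := (U l).mul_inv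
      simp only [δ, map_add, map_sub, map_mul, ← hU]
      linear_combination (-(U l : R)) * e1 + (U j : R) * e2
    have h2 : IsUnit (f (δ j l)) :=
      IsLocalization.map_units R (⟨δ j l, Submonoid.subset_closure (.inr ⟨j, l, hjl, rfl⟩)⟩ : S)
    rw [← h1] at h2
    exact isUnit_of_mul_isUnit_right h2

section Semigroups

variable {J 𝕜 : Type*} {X : Type u} [RCLike 𝕜] [NormedAddCommGroup X] [NormedSpace 𝕜 X]
  [NormedSpace ℝ X] [IsScalarTower ℝ 𝕜 X]

/-- A bounded operator commuting with the semigroup maps the graph of the generator into itself, and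
the resolvent is read off from the graph. -/
theorem IsGenerator.resolvent_comm {A : X →ₗ.[𝕜] X} {T : ℝ → X →L[𝕜] X} (hA : IsGenerator A T)
    {c : ℝ} {ρ : X →L[𝕜] X} (hρ : ∀ x y, (x, y) ∈ A.graph ↔ ρ (c • x - y) = x) {S : X →L[𝕜] X}
    (hS : ∀ t, 0 ≤ t → S.comp (T t) = (T t).comp S) : S.comp ρ = ρ.comp S := by
  ext w
  have h1 : (ρ w, c • ρ w - w) ∈ A.graph := by rw [hρ, sub_sub_cancel]
  have h2 := (hρ _ _).1 (hA.graph_map hS h1)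
  rw [← ContinuousLinearMap.map_smul_of_tower, ← map_sub, sub_sub_cancel] at h2
  exact h2.symm

/-- Resolvents of commuting generators commute. -/
theorem exists_commuting_resolvents [CompleteSpace X] {B : J → X →ₗ.[𝕜] X} {T : J → ℝ → X →L[𝕜] X}
    (hT : ∀ j, IsC0Semigroup (T j)) (hBT : ∀ j, IsGenerator (B j) (T j))
    (hcomm : ∀ (j k : J) (t s : ℝ), 0 ≤ t → 0 ≤ s → (T j t).comp (T k s) = (T k s).comp (T j t)) :
    ∃ (c : J → ℝ) (ρ : J → X →L[𝕜] X),
      (∀ j x y, (x, y) ∈ (B j).graph ↔ ρ j (c j • x - y) = x) ∧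
      ∀ j l, (ρ j).comp (ρ l) = (ρ l).comp (ρ j) := by
  choose c ρ hρ using fun j => (hBT j).exists_resolvent (hT j)
  refine ⟨c, ρ, hρ, fun j l => ?_⟩
  refine (hBT l).resolvent_comm (hρ l) fun t ht => ?_
  exact ((hBT j).resolvent_comm (hρ j) fun s hs => hcomm l j t s ht hs).symm

-- The ring acting on `X` is the algebra generated by the resolvents, commutative because its
-- generators commute.
open scoped IsMulCommutative in
theorem exists_isModel {B : J → X →ₗ.[𝕜] X} {c : J → ℝ} {ρ : J → X →L[𝕜] X}
    (hρ : ∀ j x y, (x, y) ∈ (B j).graph ↔ ρ j (c j • x - y) = x)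
    (hcomm : ∀ j l, (ρ j).comp (ρ l) = (ρ l).comp (ρ j))
    (hB : ∀ j l, j ≠ l → ∀ x y, (x, y) ∈ (B j).graph → (x, y) ∈ (B l).graph → x = 0) :
    ∃ (R V : Type u) (_ : CommRing R) (_ : AddCommGroup V) (_ : Module R V) (ι : X →+ V) (b : J → R),
      IsModel B ι b := by
  have hc : ∀ f ∈ Set.range ρ, ∀ g ∈ Set.range ρ, f * g = g * f := by
    rintro _ ⟨j, rfl⟩ _ ⟨l, rfl⟩
    exact hcomm j l
  have : IsMulCommutative (Algebra.adjoin 𝕜 (Set.range ρ)) := Algebra.isMulCommutative_adjoin 𝕜 hc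
  refine exists_isModel_of_resolvents (A := Algebra.adjoin 𝕜 (Set.range ρ))
    (ρ := fun j => ⟨ρ j, Algebra.subset_adjoin ⟨j, rfl⟩⟩)
    (c := fun j => algebraMap 𝕜 _ (c j : 𝕜)) (fun j x y => ?_) hB
  rw [hρ, RCLike.real_smul_eq_coe_smul (K := 𝕜)]
  exact Iff.rfl

end Semigroups

/-! ### Polynomials acting on sequences through the shift -/

section ShiftAction

open Polynomial

variable {R V : Type*} [CommRing R] [AddCommGroup V] [Module R V]

/-- The polynomial ring acts on sequences, with `X` acting as the shift. -/
def act : R[X] →ₐ[R] Module.End R (ℕ → V) := aeval (LinearMap.funLeft R V Nat.succ)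

theorem act_mul (p q : R[X]) (w : ℕ → V) : act (p * q) w = act p (act q w) := by
  rw [map_mul]; rfl

theorem act_X (w : ℕ → V) (k : ℕ) : act (X : R[X]) w k = w (k + 1) := by
  simp [act]

theorem act_C (a : R) (w : ℕ → V) : act (C a) w = a • w := by
  simp [act, Algebra.algebraMap_eq_smul_one]

theorem act_X_pow (m : ℕ) (w : ℕ → V) (k : ℕ) : act (X ^ m : R[X]) w k = w (k + m) := by
  induction m generalizing k with
  | zero => simp
  | succ m ih => rw [pow_succ', act_mul, act_X, ih]; congr 1; ring

theorem act_X_add_C (a : R) (w : ℕ → V) (k : ℕ) :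
    act (X + C a) w k = w (k + 1) + a • w k := by
  rw [map_add, LinearMap.add_apply, Pi.add_apply, act_X, act_C, Pi.smul_apply]

theorem act_X_sub_C (a : R) (w : ℕ → V) : act (X - C a) w = act (X : R[X]) w - a • w := by
  rw [map_sub, LinearMap.sub_apply, act_C]

theorem act_X_pow_eq_zero_iff {S : ℕ} {w : ℕ → V} :
    act (X ^ S : R[X]) w = 0 ↔ ∀ k, S ≤ k → w k = 0 := by
  constructor
  · intro h k hk
    have := congrFun h (k - S)
    rwa [act_X_pow, Nat.sub_add_cancel hk] at this
  · intro h
    funext k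
    rw [act_X_pow]
    exact h _ (Nat.le_add_left _ _)

theorem act_apply (p : R[X]) (w : ℕ → V) (k : ℕ) : act p w k = act (X ^ k * p) w 0 := by
  rw [act_mul, act_X_pow, zero_add]

theorem act_eq_zero_of_dvd {p q : R[X]} (h : p ∣ q) {w : ℕ → V} (hw : act p w = 0) :
    act q w = 0 := by
  obtain ⟨r, rfl⟩ := h
  rw [mul_comm, act_mul, hw, map_zero]

theorem eq_zero_of_act_coprime {p q : R[X]} (h : IsCoprime p q) {w : ℕ → V} (hp : act p w = 0)
    (hq : act q w = 0) : w = 0 := by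
  obtain ⟨a, b, hab⟩ := h
  have : act (a * p + b * q) w = 0 := by
    rw [map_add, LinearMap.add_apply, act_mul, act_mul, hp, hq, map_zero, map_zero, add_zero]
  rwa [hab, map_one] at this

theorem act_apply_zero (p : R[X]) {w : ℕ → V} {S : ℕ} (hw : ∀ k, S ≤ k → w k = 0) :
    act p w 0 = ∑ k ∈ Finset.range S, p.coeff k • w k := by
  induction p using Polynomial.induction_on' with
  | add p q hp hq =>
    rw [map_add, LinearMap.add_apply, Pi.add_apply, hp, hq, ← Finset.sum_add_distrib]
    simp [add_smul]
  | monomial m a =>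
    rw [← C_mul_X_pow_eq_monomial, act_mul, act_C, Pi.smul_apply, act_X_pow, zero_add]
    simp only [coeff_C_mul, coeff_X_pow, mul_ite, mul_one, mul_zero, ite_smul, zero_smul,
      Finset.sum_ite_eq', Finset.mem_range]
    split_ifs with h
    · rfl
    · rw [hw m (by omega), smul_zero]

/-- If `w` is finitely supported then so is the solution `w'` of `(X + d) w' = w`, `d` a unit. -/
theorem exists_act_X_add_C_eq {d : R} (hd : IsUnit d) {w : ℕ → V} {S : ℕ}
    (hw : ∀ k, S ≤ k → w k = 0) :
    ∃ w' : ℕ → V, (∀ k, S ≤ k → w' k = 0) ∧ act (X + C d) w' = w ∧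
      ∀ k, d • w' k = ∑ a ∈ Finset.range S, (-(↑hd.unit⁻¹ : R)) ^ a • w (k + a) := by
  set e : R := ↑hd.unit⁻¹ with he
  have hde : d * e = 1 := hd.mul_val_inv
  -- The geometric series `(X + d)⁻¹ = ∑ a, d⁻¹ (-d⁻¹ X) ^ a`, finite because `X` is nilpotent on
  -- sequences vanishing from `S` on.
  refine ⟨fun k => ∑ a ∈ Finset.range S, (e * (-e) ^ a) • w (k + a), ?_, ?_, ?_⟩
  · intro k hk
    exact Finset.sum_eq_zero fun a _ => by rw [hw _ (by omega), smul_zero]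
  · funext k
    rw [act_X_add_C, Finset.smul_sum]
    have h1 : ∀ a ∈ Finset.range S, d • (e * (-e) ^ a) • w (k + a) = (-e) ^ a • w (k + a) := by
      intro a _
      rw [smul_smul, ← mul_assoc, hde, one_mul]
    have h2 : ∀ a ∈ Finset.range S, (e * (-e) ^ a) • w (k + 1 + a)
        = - ((-e) ^ (a + 1) • w (k + (a + 1))) := by
      intro a _
      rw [← neg_smul, add_assoc, add_comm 1 a]
      congr 1
      ring
    rw [Finset.sum_congr rfl h1, Finset.sum_congr rfl h2, Finset.sum_neg_distrib, neg_add_eq_sub,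
      ← Finset.sum_sub_distrib, Finset.sum_range_sub' fun a => (-e) ^ a • w (k + a)]
    simp [hw (k + S) (by omega)]
  · intro k
    rw [Finset.smul_sum]
    refine Finset.sum_congr rfl fun a _ => ?_
    rw [smul_smul, ← mul_assoc, hde, one_mul]

end ShiftAction

/-! ### The confluent Vandermonde system over a commutative ring -/

section Confluent

open Polynomial

variable {R V J : Type*} [CommRing R] [AddCommGroup V] [Module R V] [Fintype J]

/-- The functional `p ↦ ∑ l, (p(X + b l) y l)(0)`. -/
def confluentFunctional (b : J → R) (y : J → ℕ → V) : R[X] →ₗ[R] V where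
  toFun p := ∑ l, act (taylorAlgHom (b l) p) (y l) 0
  map_add' p q := by simp [Finset.sum_add_distrib]
  map_smul' a p := by simp [Finset.smul_sum]

theorem confluentFunctional_apply (b : J → R) (y : J → ℕ → V) (p : R[X]) :
    confluentFunctional b y p = ∑ l, act (taylorAlgHom (b l) p) (y l) 0 := rfl

variable [DecidableEq J]

/-- `(X - b j) ^ k ∏_{l ≠ j} (X - b l) ^ S l`. -/
def blockPoly (b : J → R) (S : J → ℕ) (j : J) (k : ℕ) : R[X] :=
  ∏ l, (X - C (b l)) ^ (if l = j then k else S l)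

/-- `∏_{l ≠ j} (X + (b j - b l)) ^ S l`. -/
def localPoly (b : J → R) (S : J → ℕ) (j : J) : R[X] :=
  ∏ l, (X + C (b j - b l)) ^ (if l = j then 0 else S l)

theorem taylorAlgHom_X_sub_C (a c : R) : taylorAlgHom a (X - C c) = X + C (a - c) := by
  simp [taylor_apply, sub_eq_add_neg, add_assoc]

theorem taylor_blockPoly (b : J → R) (S : J → ℕ) (j l : J) (k : ℕ) :
    taylorAlgHom (b l) (blockPoly b S j k)
      = ∏ m, (X + C (b l - b m)) ^ (if m = j then k else S m) := by
  rw [blockPoly, map_prod]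
  simp only [map_pow, taylorAlgHom_X_sub_C]

theorem taylor_blockPoly_self (b : J → R) (S : J → ℕ) (j : J) (k : ℕ) :
    taylorAlgHom (b j) (blockPoly b S j k) = X ^ k * localPoly b S j := by
  rw [taylor_blockPoly, localPoly, ← Finset.mul_prod_erase _ _ (Finset.mem_univ j),
    ← Finset.mul_prod_erase Finset.univ (fun l => (X + C (b j - b l)) ^ (if l = j then 0 else S l))
      (Finset.mem_univ j)]
  simp only [sub_self, map_zero, add_zero, if_true, pow_zero, one_mul]
  congr 1
  refine Finset.prod_congr rfl fun m hm => ?_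
  simp [Finset.ne_of_mem_erase hm]

/-- For `l ≠ j`, the factor `(X - b l) ^ S l` becomes `X ^ S l` after translation by `b l` and kills
`y l`, so only block `j` contributes. -/
theorem confluentFunctional_blockPoly (b : J → R) {S : J → ℕ} {y : J → ℕ → V}
    (hy : ∀ l k, S l ≤ k → y l k = 0) (j : J) (k : ℕ) :
    confluentFunctional b y (blockPoly b S j k) = act (localPoly b S j) (y j) k := by
  rw [confluentFunctional_apply, Finset.sum_eq_single j]
  · rw [taylor_blockPoly_self, ← act_apply]
  · intro l _ hl
    rw [act_eq_zero_of_dvd _ (act_X_pow_eq_zero_iff.2 (hy l)), Pi.zero_apply]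
    rw [taylor_blockPoly]
    refine dvd_trans ?_ (Finset.dvd_prod_of_mem _ (Finset.mem_univ l))
    simp [hl]
  · simp

theorem blockPoly_monic (b : J → R) (S : J → ℕ) (j : J) (k : ℕ) : (blockPoly b S j k).Monic :=
  monic_prod_of_monic _ _ fun _ _ => (monic_X_sub_C _).pow _

theorem degree_blockPoly_lt (b : J → R) {S : J → ℕ} {j : J} {k : ℕ} (hk : k < S j) :
    (blockPoly b S j k).degree < (∑ l, S l : ℕ) := by
  rcases subsingleton_or_nontrivial R with h | h
  · rw [Subsingleton.elim (blockPoly b S j k) 0, degree_zero]; exact WithBot.bot_lt_coe _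
  · rw [degree_eq_natDegree (blockPoly_monic b S j k).ne_zero, blockPoly,
      natDegree_prod_of_monic _ _ fun l _ => (monic_X_sub_C _).pow _]
    rw [Nat.cast_lt]
    refine Finset.sum_lt_sum (fun l _ => ?_) ⟨j, Finset.mem_univ _, ?_⟩
    · rw [(monic_X_sub_C _).natDegree_pow, natDegree_X_sub_C, mul_one]
      split_ifs with h
      · subst h; exact hk.le
      · exact le_rfl
    · rw [(monic_X_sub_C _).natDegree_pow, natDegree_X_sub_C, mul_one]
      simpa using hk

theorem isCoprime_X_add_C {a c : R} (h : IsUnit (a - c)) : IsCoprime (X + C a) (X + C c : R[X]) := by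
  obtain ⟨u, hu⟩ := h
  refine ⟨C (↑u⁻¹ : R), -C (↑u⁻¹ : R), ?_⟩
  have : C (↑u⁻¹ : R) * (X + C a) + -C (↑u⁻¹ : R) * (X + C c) = C ((↑u⁻¹ : R) * (a - c)) := by
    simp only [map_mul, map_sub]; ring
  rw [this, ← hu, Units.inv_mul, map_one]

theorem isCoprime_localPoly {b : J → R} (hb : ∀ j l, j ≠ l → IsUnit (b j - b l)) (S : J → ℕ) (j : J)
    (k : ℕ) : IsCoprime (localPoly b S j) (X ^ k) := by
  refine (IsCoprime.prod_left fun l _ => ?_)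
  by_cases hl : l = j
  · simp [hl, isCoprime_one_left]
  · rw [if_neg hl]
    refine IsCoprime.pow ?_
    have := isCoprime_X_add_C (R := R) (a := b j - b l) (c := 0) (by simpa using hb j l (Ne.symm hl))
    simpa using this

theorem map_eq_zero_of_degree_lt {f : R[X] →ₗ[R] V} {n : ℕ} (hf : ∀ r < n, f (X ^ r) = 0) {p : R[X]}
    (hp : p.degree < n) : f p = 0 := by
  classical
  have h1 := mem_degreeLT.2 hp
  rw [degreeLT_eq_span_X_pow] at h1
  refine (Submodule.span_le (p := LinearMap.ker f)).2 ?_ h1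
  intro q hq
  obtain ⟨r, hr, rfl⟩ := Finset.mem_image.1 (Finset.mem_coe.1 hq)
  exact hf r (Finset.mem_range.1 hr)

/-- Testing on the block polynomials shows that `localPoly` kills `y j`; so does the coprime
polynomial `X ^ S j`, and Bézout gives `y j = 0`. -/
theorem eq_zero_of_confluentFunctional_eq_zero {b : J → R} (hb : ∀ j l, j ≠ l → IsUnit (b j - b l))
    {S : J → ℕ} {y : J → ℕ → V} (hy : ∀ l k, S l ≤ k → y l k = 0)
    (h : ∀ r < ∑ l, S l, confluentFunctional b y (X ^ r) = 0) : y = 0 := by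
  funext j
  refine eq_zero_of_act_coprime (isCoprime_localPoly hb S j (S j)) ?_ (act_X_pow_eq_zero_iff.2 (hy j))
  funext k
  by_cases hk : k < S j
  · rw [← confluentFunctional_blockPoly b hy]
    exact map_eq_zero_of_degree_lt h (degree_blockPoly_lt b hk)
  · rw [act_apply, ← mul_comm, act_mul, act_eq_zero_of_dvd (pow_dvd_pow X (not_lt.1 hk))
      (act_X_pow_eq_zero_iff.2 (hy j)), map_zero]
    rfl

theorem blockPoly_eq (b : J → R) (S : J → ℕ) (j : J) (k : ℕ) :
    blockPoly b S j k = (X - C (b j)) ^ k * ∏ l ∈ Finset.univ \ {j}, (X - C (b l)) ^ S l := by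
  rw [blockPoly, ← Finset.mul_prod_erase _ _ (Finset.mem_univ j), if_pos rfl, Finset.sdiff_singleton_eq_erase]
  congr 1
  refine Finset.prod_congr rfl fun m hm => ?_
  simp [Finset.ne_of_mem_erase hm]

/-- The polynomials `blockPoly b S j k`, `k < S j`, span the polynomials of degree `< ∑ S`. -/
theorem mem_span_blockPoly {b : J → R} (hb : ∀ j l, j ≠ l → IsUnit (b j - b l)) {S : J → ℕ} {p : R[X]}
    (hp : p.degree < (∑ l, S l : ℕ)) :
    p ∈ Submodule.span R {q | ∃ j, ∃ k < S j, q = blockPoly b S j k} := by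
  rcases subsingleton_or_nontrivial R with h | h
  · rw [Subsingleton.elim p 0]; exact zero_mem _
  set W := Submodule.span R {q | ∃ j, ∃ k < S j, q = blockPoly b S j k} with hW
  set P : R[X] := ∏ l, (X - C (b l)) ^ S l with hP
  have hPm : P.Monic := monic_prod_of_monic _ _ fun l _ => (monic_X_sub_C _).pow _
  have hPd : P.degree = (∑ l, S l : ℕ) := by
    rw [degree_eq_natDegree hPm.ne_zero, hP,
      natDegree_prod_of_monic _ _ fun l _ => (monic_X_sub_C _).pow _]
    congr 1
    refine Finset.sum_congr rfl fun l _ => ?_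
    rw [(monic_X_sub_C _).natDegree_pow, natDegree_X_sub_C, mul_one]
  have hWd : ∀ q ∈ W, q.degree < (∑ l, S l : ℕ) := by
    intro q hq
    rw [← mem_degreeLT]
    refine (Submodule.span_le.2 ?_) hq
    rintro _ ⟨j, k, hk, rfl⟩
    exact mem_degreeLT.2 (degree_blockPoly_lt b hk)
  rcases isEmpty_or_nonempty J with hJ | hJ
  · simp only [Finset.univ_eq_empty, Finset.sum_empty, Nat.cast_zero] at hp
    rw [degree_eq_bot.1 (Nat.WithBot.lt_zero_iff.1 hp)]
    exact zero_mem _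
  -- First the span is shown to be everything modulo `P`; degrees remove the multiple of `P` at the
  -- end.
  set W' : Submodule R R[X] := W ⊔ (Ideal.span {P}).restrictScalars R with hW'
  have hPW' : ∀ q, P ∣ q → q ∈ W' := fun q hq =>
    Submodule.mem_sup_right (Ideal.mem_span_singleton.2 hq)
  have hQ : ∀ (h : R[X]) (j : J), h * ∏ l ∈ Finset.univ \ {j}, (X - C (b l)) ^ S l ∈ W' := by
    intro h j
    -- Expanding `h` in powers of `X - b j` gives block polynomials for `k < S j` and multiples of
    -- `P` for `k ≥ S j`.
    rw [← sum_taylor_eq h (b j), Polynomial.sum, Finset.sum_mul]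
    refine Submodule.sum_mem _ fun k _ => ?_
    rw [mul_assoc, ← blockPoly_eq, ← smul_eq_C_mul]
    refine Submodule.smul_mem _ _ ?_
    by_cases hk : k < S j
    · exact Submodule.mem_sup_left (Submodule.subset_span ⟨j, k, hk, rfl⟩)
    · refine hPW' _ ?_
      refine Finset.prod_dvd_prod_of_dvd _ _ fun l _ => pow_dvd_pow _ ?_
      split_ifs with h
      · subst h; exact not_lt.1 hk
      · exact le_rfl
  -- Partition of unity from the pairwise coprime powers: `1` is a combination of the products
  -- omitting one block.
  obtain ⟨μ, hμ⟩ := (exists_sum_eq_one_iff_pairwise_coprime' (s := fun l => (X - C (b l)) ^ S l)).2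
    fun j l hjl => IsCoprime.pow (by
      have := isCoprime_X_add_C (R := R) (a := -b j) (c := -b l)
        (by have := hb l j (Ne.symm hjl); rwa [neg_sub_neg])
      simpa [sub_eq_add_neg] using this)
  have hpW' : p ∈ W' := by
    rw [← mul_one p, ← hμ, Finset.mul_sum]
    refine Submodule.sum_mem _ fun j _ => ?_
    have := hQ (p * μ j) j
    rwa [mul_assoc, ← Finset.compl_eq_univ_sdiff] at this
  obtain ⟨q, hq, g, hg, rfl⟩ := Submodule.mem_sup.1 hpW'
  have hg0 : g = 0 := by
    by_contra hne
    refine hPm.not_dvd_of_degree_lt hne ?_ (Ideal.mem_span_singleton.1 hg)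
    rw [hPd]
    have := (degree_sub_le (q + g) q).trans_lt (max_lt hp (hWd q hq))
    rwa [add_sub_cancel_left] at this
  rw [hg0, add_zero]
  exact hq

theorem map_eq_zero_of_blockPoly {b : J → R} (hb : ∀ j l, j ≠ l → IsUnit (b j - b l)) {S : J → ℕ}
    {f : R[X] →ₗ[R] V} (hf : ∀ j, ∀ k < S j, f (blockPoly b S j k) = 0) {p : R[X]}
    (hp : p.degree < (∑ l, S l : ℕ)) : f p = 0 := by
  refine (Submodule.span_le (p := LinearMap.ker f)).2 ?_ (mem_span_blockPoly hb hp)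
  rintro _ ⟨j, k, hk, rfl⟩
  exact hf j k hk

end Confluent

/-! ### Inverting the local factors under the range condition -/

section Division

open Polynomial

variable {R V J : Type*} [CommRing R] [AddCommGroup V] [Module R V] [Fintype J]

/-- If all `w k` are divisible, within the subgroup `G`, by `∏ d` over the list `L` times the monomials
in the `d l` of degree at most `k`, then `∏_{l ∈ L} (X + d l)` can be inverted on `w`, with result
in `G`. -/
theorem exists_act_prod_eq [DecidableEq J] {d : J → R} (hd : ∀ l, IsUnit (d l)) {S : ℕ}
    (G : AddSubgroup V) (L : List J) {w : ℕ → V}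
    (hw : ∀ k, S ≤ k → w k = 0)
    (hL : ∀ k < S, ∀ m : J → ℕ, ∑ l, m l ≤ k → ∃ g ∈ G, ((L.map d).prod * ∏ l, d l ^ m l) • g = w k) :
    ∃ y : ℕ → V, (∀ k, S ≤ k → y k = 0) ∧ (∀ k, y k ∈ G) ∧
      act (L.map fun l => X + C (d l)).prod y = w := by
  induction L generalizing w with
  | nil =>
    refine ⟨w, hw, fun k => ?_, by simp⟩
    by_cases hk : k < S
    · obtain ⟨g, hg, h⟩ := hL k hk 0 (by simp)
      simp only [List.map_nil, List.prod_nil, Pi.zero_apply, pow_zero, Finset.prod_const_one,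
        mul_one, one_smul] at h
      rwa [← h]
    · rw [hw k (not_lt.1 hk)]; exact zero_mem _
  | cons i L ih =>
    obtain ⟨w', hw', hact, hformula⟩ := exists_act_X_add_C_eq (hd i) hw
    refine (ih hw' fun k hk m hm => ?_).imp fun y ⟨hy, hyG, hyw⟩ => ⟨hy, hyG, by
      rw [List.map_cons, List.prod_cons, act_mul, hyw, hact]⟩
    -- The term `d i ^ (-a) • w (k + a)` costs `a` further factors `d i`. They are available since
    -- `m` raised by `a` at `i` has total at most `k + a`: this is why the extra exponents are
    -- bounded by the index `k`.
    have key : ∀ a ∈ Finset.range S, ∃ g ∈ G,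
        ((L.map d).prod * ∏ l, d l ^ m l) • d i • g
          = (-(↑(hd i).unit⁻¹ : R)) ^ a • w (k + a) := by
      intro a _
      by_cases hka : k + a < S
      · obtain ⟨g, hg, h⟩ := hL (k + a) hka (m + Pi.single i a) (by
          simp only [Pi.add_apply, Finset.sum_add_distrib, Finset.sum_pi_single', Finset.mem_univ,
            if_true]
          omega)
        refine ⟨(-1 : ℤ) ^ a • g, G.zsmul_mem hg _, ?_⟩
        have h1 : ∏ l, d l ^ (m + Pi.single i a : J → ℕ) l = (∏ l, d l ^ m l) * d i ^ a := by
          simp only [Pi.add_apply, pow_add, Finset.prod_mul_distrib]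
          congr 1
          rw [Finset.prod_eq_single i]
          · simp
          · intro l _ hl; simp [hl]
          · simp
        have h2 : d i * (↑(hd i).unit⁻¹ : R) = 1 := (hd i).mul_val_inv
        rw [← h, h1, List.map_cons, List.prod_cons, ← Int.cast_smul_eq_zsmul R, smul_smul, smul_smul,
          smul_smul]
        congr 1
        have h3 : (↑(hd i).unit⁻¹ : R) ^ a * d i ^ a = 1 := by
          rw [← mul_pow, mul_comm, h2, one_pow]
        rw [neg_pow]
        push_cast
        linear_combination (-(L.map d).prod * (∏ l, d l ^ m l) * d i * (-1) ^ a) * h3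
      · exact ⟨0, zero_mem _, by rw [hw _ (not_lt.1 hka)]; simp⟩
    choose! g hgG hg using key
    refine ⟨∑ a ∈ Finset.range S, g a, G.sum_mem hgG, ?_⟩
    have h1 : d i • (((L.map d).prod * ∏ l, d l ^ m l) • ∑ a ∈ Finset.range S, g a) = d i • w' k := by
      rw [hformula, smul_comm, Finset.smul_sum, Finset.smul_sum]
      exact Finset.sum_congr rfl hg
    exact (hd i).smul_left_cancel.1 h1

end Division

/-! ### Transfer of graphs, initial values and the operator matrix to the ring -/

section Graphs

open Polynomial

variable {𝕜 X R V : Type*} [Field 𝕜] [AddCommGroup X] [Module 𝕜 X] [CommRing R]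
    [AddCommGroup V] [Module R V]

theorem mem_graph_sub {f g : X →ₗ.[𝕜] X} {x z : X} (h : (x, z) ∈ (f - g).graph) :
    ∃ y y', (x, y) ∈ f.graph ∧ (x, y') ∈ g.graph ∧ z = y - y' := by
  obtain ⟨⟨a, ha⟩, rfl, rfl⟩ := (LinearPMap.mem_graph_iff _).1 h
  exact ⟨_, _, f.mem_graph ⟨a, ha.1⟩, g.mem_graph ⟨a, ha.2⟩, rfl⟩

theorem sub_mem_graph {f g : X →ₗ.[𝕜] X} {x y y' : X} (hf : (x, y) ∈ f.graph)
    (hg : (x, y') ∈ g.graph) : (x, y - y') ∈ (f - g).graph := by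
  obtain ⟨⟨a, ha⟩, rfl, rfl⟩ := (LinearPMap.mem_graph_iff _).1 hf
  obtain ⟨⟨a', ha'⟩, h, rfl⟩ := (LinearPMap.mem_graph_iff _).1 hg
  obtain rfl : a' = a := h
  exact (LinearPMap.mem_graph_iff _).2 ⟨⟨a', ha, ha'⟩, rfl, rfl⟩

theorem eq_of_mem_graph_of_injective_sub {f g : X →ₗ.[𝕜] X} (h : Function.Injective (f - g)) {x y : X}
    (hf : (x, y) ∈ f.graph) (hg : (x, y) ∈ g.graph) : x = 0 := by
  obtain ⟨a, ha, ha'⟩ := (LinearPMap.mem_graph_iff _).1 (sub_mem_graph hf hg)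
  have : (f - g) a = (f - g) 0 := by rw [LinearPMap.map_zero, ha', sub_self]
  have ha : (a : X) = x := ha
  rw [← ha, h this, Submodule.coe_zero]

theorem mem_graph_idOp {x z : X} : (x, z) ∈ (idOp : X →ₗ.[𝕜] X).graph ↔ z = x := by
  constructor
  · intro h
    obtain ⟨a, rfl, rfl⟩ := (LinearPMap.mem_graph_iff _).1 h
    rfl
  · rintro rfl
    exact (LinearPMap.mem_graph_iff _).2 ⟨⟨z, trivial⟩, rfl, rfl⟩

theorem commonDomain_zero_mem {i : ℕ} (B : Fin i → X →ₗ.[𝕜] X) (N : ℕ) : (0 : X) ∈ commonDomain B N := by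
  induction N with
  | zero => trivial
  | succ N ih => exact fun j => ⟨0, ih, (B j).graph.zero_mem⟩

/-- The common domain as a subgroup. -/
def commonDomainSubgroup {i : ℕ} (B : Fin i → X →ₗ.[𝕜] X) (N : ℕ) : AddSubgroup X where
  carrier := commonDomain B N
  zero_mem' := commonDomain_zero_mem B N
  add_mem' := by
    induction N with
    | zero => intros; trivial
    | succ N ih =>
      intro x y hx hy j
      obtain ⟨x', hx', hx⟩ := hx j
      obtain ⟨y', hy', hy⟩ := hy j
      exact ⟨x' + y', ih hx' hy', (B j).graph.add_mem hx hy⟩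
  neg_mem' := by
    induction N with
    | zero => intros; trivial
    | succ N ih =>
      intro x hx j
      obtain ⟨x', hx', hx⟩ := hx j
      exact ⟨-x', ih hx', (B j).graph.neg_mem hx⟩

theorem commonDomain_succ_subset {i : ℕ} (B : Fin i → X →ₗ.[𝕜] X) (N : ℕ) :
    commonDomain B (N + 1) ⊆ commonDomain B N := by
  induction N with
  | zero => intros x _; trivial
  | succ N ih =>
    intro x hx j
    obtain ⟨y, hy, h⟩ := hx j
    exact ⟨y, ih hy, h⟩

theorem exists_mem_graph_powOp {i : ℕ} {B : Fin i → X →ₗ.[𝕜] X} (j : Fin i) {p N : ℕ} {x : X}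
    (hx : x ∈ commonDomain B (N + p)) : ∃ z ∈ commonDomain B N, (x, z) ∈ (powOp (B j) p).graph := by
  induction p generalizing N with
  | zero => exact ⟨x, hx, mem_graph_idOp.2 rfl⟩
  | succ p ih =>
    obtain ⟨y, hy, hxy⟩ := ih (N := N + 1) (by rwa [add_assoc, add_comm 1])
    obtain ⟨z, hz, hyz⟩ := hy j
    exact ⟨z, hz, mem_graph_prodOp.2 ⟨y, hxy, hyz⟩⟩

theorem mem_domain_powOp {i : ℕ} {B : Fin i → X →ₗ.[𝕜] X} (j : Fin i) {p N : ℕ} (hp : p ≤ N) {x : X}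
    (hx : x ∈ commonDomain B N) : x ∈ (powOp (B j) p).domain := by
  obtain ⟨z, -, h⟩ := exists_mem_graph_powOp (B := B) j (p := p) (N := N - p) (x := x)
    (by rwa [Nat.sub_add_cancel hp])
  exact LinearPMap.mem_domain_of_mem_graph h

section Model

variable {J : Type*} {B : J → X →ₗ.[𝕜] X} {ι : X →+ V} {b : J → R}

theorem IsModel.powOp (hM : IsModel B ι b) {j : J} {p : ℕ} {x z : X}
    (h : (x, z) ∈ (powOp (B j) p).graph) : b j ^ p • ι x = ι z := by
  induction p generalizing z with
  | zero => rw [mem_graph_idOp.1 h, pow_zero, one_smul]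
  | succ p ih =>
    obtain ⟨y, hxy, hyz⟩ := mem_graph_prodOp.1 h
    rw [← (hM.mem_graph_iff _ _ _).1 hyz, ← ih hxy, smul_smul, pow_succ']

theorem IsModel.listProd_sub (hM : IsModel B ι b) {j : J} {L : List J} {x z : X}
    (h : (x, z) ∈ (listProd (L.map fun l => B j - B l)).graph) :
    (L.map fun l => b j - b l).prod • ι x = ι z := by
  induction L generalizing z with
  | nil => rw [mem_graph_idOp.1 h, List.map_nil, List.prod_nil, one_smul]
  | cons l L ih =>
    obtain ⟨y, hxy, hyz⟩ := mem_graph_prodOp.1 h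
    obtain ⟨z₁, z₂, h₁, h₂, rfl⟩ := mem_graph_sub hyz
    rw [map_sub, ← (hM.mem_graph_iff _ _ _).1 h₁, ← (hM.mem_graph_iff _ _ _).1 h₂, ← ih hxy,
      ← sub_smul, smul_smul, List.map_cons, List.prod_cons]

/-- Passing from `u` to `u'` shifts the sequence of derivatives, so each factor `d/dt - B l` becomes
`X - b l` acting on that sequence. -/
theorem IsModel.isInitialValue (hM : IsModel B ι b) {L : List J} {x : ℕ → X} {z : X}
    (h : IsInitialValue (L.map B) x z) :
    ι z = act (L.map fun l => Polynomial.X - C (b l)).prod (fun k => ι (x k)) 0 := by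
  induction L generalizing x z with
  | nil => rw [show z = x 0 from h]; simp
  | cons l L ih =>
    obtain ⟨v, v', hv, hv', hz⟩ := h
    have h1 := (hM.mem_graph_iff _ _ _).1 hz
    have h2 : act (Polynomial.X : R[X]) (fun k => ι (x k)) = fun k => ι (x (k + 1)) :=
      funext fun k => act_X _ k
    rw [map_sub, ih hv, ih hv'] at h1
    rw [List.map_cons, List.prod_cons, mul_comm, act_mul, act_X_sub_C, map_sub, h2, map_smul,
      Pi.sub_apply, Pi.smul_apply, h1, sub_sub_cancel]

end Model

section Matrix

variable {n i : ℕ} {σ : Fin n → Fin i} {B : Fin i → X →ₗ.[𝕜] X} {ι : X →+ V} {b : Fin i → R}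

/-- The coefficients of block `j`, extended by zero. -/
def coeffSeq (y : Coeff σ → X) (j : Fin i) (k : ℕ) : X :=
  if h : k < mult σ j then y ⟨j, k, h⟩ else 0

theorem coeffSeq_of_le (y : Coeff σ → X) (j : Fin i) {k : ℕ} (hk : mult σ j ≤ k) :
    coeffSeq y j k = 0 := dif_neg (not_lt.2 hk)

theorem coeffSeq_coe (y : Coeff σ → X) (j : Fin i) (k : Fin (mult σ j)) :
    coeffSeq y j k = y ⟨j, k⟩ := dif_pos k.2

theorem sum_mult (σ : Fin n → Fin i) : ∑ j, mult σ j = n := by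
  have := Finset.card_eq_sum_card_fiberwise (f := σ) (s := Finset.univ) (t := Finset.univ)
    fun _ _ => Finset.mem_coe.2 (Finset.mem_univ _)
  simpa [mult] using this.symm

/-- The binomial expansion of `(X + b j) ^ r` produces the matrix entries of row `r`. -/
theorem confluentFunctional_X_pow (b : Fin i → R) {y : Fin i → ℕ → V} {S : Fin i → ℕ}
    (hy : ∀ l k, S l ≤ k → y l k = 0) (r : ℕ) :
    confluentFunctional b y (Polynomial.X ^ r)
      = ∑ j, ∑ k : Fin (S j), r.choose k • b j ^ (r - k) • y j k := by
  rw [confluentFunctional_apply]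
  refine Finset.sum_congr rfl fun j _ => ?_
  rw [act_apply_zero _ (hy j), ← Fin.sum_univ_eq_sum_range (fun k => _ • y j k)]
  refine Finset.sum_congr rfl fun k _ => ?_
  have hX : taylorAlgHom (b j) Polynomial.X = Polynomial.X + C (b j) := by simp
  rw [map_pow, hX, coeff_X_add_C_pow, mul_comm, mul_smul,
    Nat.cast_smul_eq_nsmul]

theorem IsModel.map_matrixM (hM : IsModel B ι b) {y : Coeff σ → X}
    (hy : y ∈ (matrixM σ B).domain) (r : Fin n) :
    ι (matrixM σ B ⟨y, hy⟩ r)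
      = confluentFunctional b (fun j k => ι (coeffSeq y j k)) (Polynomial.X ^ (r : ℕ)) := by
  rw [confluentFunctional_X_pow b (S := mult σ) fun l k hk => by
    rw [coeffSeq_of_le y l hk, map_zero]]
  refine Eq.trans ?_ (Fintype.sum_sigma fun c : Coeff σ => (r : ℕ).choose (c.2 : ℕ) •
    b c.1 ^ ((r : ℕ) - (c.2 : ℕ)) • ι (coeffSeq y c.1 c.2))
  change ι (∑ c : Coeff σ, _) = _
  rw [map_sum]
  refine Finset.sum_congr rfl fun c _ => ?_
  have hc : y c ∈ (DAlembert.powOp (B c.1) ((r : ℕ) - (c.2 : ℕ))).domain := by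
    have h := hy
    simp only [matrixM, matrixOp, Submodule.mem_iInf] at h
    exact h r c
  have h1 := hM.powOp (LinearPMap.mem_graph _ ⟨y c, hc⟩)
  rw [LinearPMap.smul_apply, coeffSeq_coe, Nat.cast_smul_eq_nsmul, map_nsmul]
  exact congrArg _ h1.symm

theorem mem_domain_matrixM {y : Coeff σ → X} (hy : ∀ c, y c ∈ commonDomain B n) :
    y ∈ (matrixM σ B).domain := by
  simp only [matrixM, matrixOp, Submodule.mem_iInf]
  exact fun r c => mem_domain_powOp c.1 ((Nat.sub_le _ _).trans r.2.le) (hy c)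

theorem IsModel.injective_matrixM (hM : IsModel B ι b) : Function.Injective (matrixM σ B) := by
  have key : ∀ y : (matrixM σ B).domain, matrixM σ B y = 0 → y = 0 := by
    rintro ⟨y, hy⟩ h
    have h1 := eq_zero_of_confluentFunctional_eq_zero (b := b) hM.isUnit_sub (S := mult σ)
      (y := fun j k => ι (coeffSeq y j k)) (fun l k hk => by rw [coeffSeq_of_le y l hk, map_zero])
      fun r hr => by
        rw [sum_mult] at hr
        rw [← hM.map_matrixM hy ⟨r, hr⟩, h, Pi.zero_apply, map_zero]
    refine Subtype.ext (funext fun ⟨j, k⟩ => ?_)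
    have h2 := congrFun (congrFun h1 j) k
    simp only [coeffSeq_coe] at h2
    exact hM.injective (h2.trans (map_zero ι).symm)
  intro y y' h
  rw [← sub_eq_zero]
  exact key _ (by rw [LinearPMap.map_sub, h, sub_self])

theorem prod_map_flatMap_replicate {M : Type*} [CommMonoid M] (e : Fin i → ℕ) (f : Fin i → M) :
    (((List.finRange i).flatMap fun l => List.replicate (e l) l).map f).prod = ∏ l, f l ^ e l := by
  rw [Fin.prod_univ_def]
  induction List.finRange i with
  | nil => simp
  | cons l L ih => simp [ih]

/-- Block by block, `localPoly` is inverted on the sequence of the `z j k`, with the solution in the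
image of the common domain. The matrix equation then holds because it holds when tested on block
polynomials. -/
theorem IsModel.exists_of_rangeLargeEnough (hM : IsModel B ι b) {x : Fin n → X}
    (hx : RangeLargeEnough σ B x) :
    ∃ y : Coeff σ → X, (∀ c, y c ∈ commonDomain B n) ∧ (y, x) ∈ (matrixM σ B).graph := by
  choose! z hz w' using hx.2
  let G : AddSubgroup V := (commonDomainSubgroup B n).map ι
  have hblock : ∀ j, ∃ η : ℕ → V, (∀ k, mult σ j ≤ k → η k = 0) ∧ (∀ k, η k ∈ G) ∧
      act (localPoly b (mult σ) j) η = fun k => if k < mult σ j then ι (z j k) else 0 := by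
    intro j
    -- The value `1` at `l = j` is a dummy unit: `j` does not occur in `L`, and powers of `d j`
    -- change nothing.
    let d : Fin i → R := fun l => if l = j then 1 else b j - b l
    let L : List (Fin i) := (List.finRange i).flatMap fun l =>
      List.replicate (if l = j then 0 else mult σ l) l
    have hd : ∀ l, IsUnit (d l) := fun l => by
      by_cases hl : l = j
      · simp [d, hl]
      · simpa [d, hl] using hM.isUnit_sub j l (Ne.symm hl)
    have hdiv : ∀ k < mult σ j, ∀ m : Fin i → ℕ, ∑ l, m l ≤ k → ∃ g ∈ G,
        ((L.map d).prod * ∏ l, d l ^ m l) • g = if k < mult σ j then ι (z j k) else 0 := by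
      intro k hk m hm
      obtain ⟨w, hw, hwz⟩ := w' j k hk m
        ((Finset.sum_le_sum_of_subset (Finset.erase_subset _ _)).trans hm)
      refine ⟨ι w, ⟨w, hw, rfl⟩, ?_⟩
      have h4 : ((List.finRange i).flatMap fun l =>
          List.replicate (if l = j then 0 else mult σ l + m l) (B j - B l))
          = ((List.finRange i).flatMap fun l =>
          List.replicate (if l = j then 0 else mult σ l + m l) l).map fun l => B j - B l := by
        simp [List.map_flatMap]
      rw [h4] at hwz
      rw [if_pos hk, ← hM.listProd_sub hwz]
      congr 1
      rw [prod_map_flatMap_replicate, prod_map_flatMap_replicate, ← Finset.prod_mul_distrib]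
      refine Finset.prod_congr rfl fun l _ => ?_
      by_cases hl : l = j
      · simp [hl, d]
      · simp [d, hl, pow_add]
    obtain ⟨η, h1, h2, h3⟩ := exists_act_prod_eq hd (S := mult σ j) G L
      (w := fun k => if k < mult σ j then ι (z j k) else 0) (fun k hk => if_neg (not_lt.2 hk)) hdiv
    refine ⟨η, h1, h2, ?_⟩
    rw [← h3, localPoly, prod_map_flatMap_replicate]
    congr 2
    refine Finset.prod_congr rfl fun l _ => ?_
    by_cases hl : l = j
    · simp [hl]
    · simp [d, hl]
  choose η hη hηG hηz using hblock
  choose y hyn hyη using hηG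
  refine ⟨fun c => y c.1 c.2, fun c => hyn _ _, ?_⟩
  have hdom : (fun c : Coeff σ => y c.1 c.2) ∈ (matrixM σ B).domain :=
    mem_domain_matrixM fun c => hyn _ _
  have hseq : (fun j k => ι (coeffSeq (fun c : Coeff σ => y c.1 c.2) j k)) = η := by
    funext j k
    by_cases hk : k < mult σ j
    · rw [coeffSeq, dif_pos hk, ← hyη]
    · rw [coeffSeq, dif_neg hk, map_zero, hη j k (not_lt.1 hk)]
  refine (LinearPMap.mem_graph_iff _).2 ⟨⟨_, hdom⟩, rfl, funext fun r => hM.injective ?_⟩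
  rw [hM.map_matrixM hdom, hseq]
  -- The difference between `p(d/dt) u` at `0` computed from the coefficients and from the data `x`.
  -- On `X ^ r` the second reads off `x r`.
  let f : R[X] →ₗ[R] V := confluentFunctional b η -
    LinearMap.proj 0 ∘ₗ (LinearMap.applyₗ (fun k => ι (extend x k))) ∘ₗ act.toLinearMap
  have hf : ∀ p, f p = confluentFunctional b η p - act p (fun k => ι (extend x k)) 0 := fun p => rfl
  have hf0 : f (Polynomial.X ^ (r : ℕ)) = 0 := by
    refine map_eq_zero_of_blockPoly hM.isUnit_sub (S := mult σ) ?_ ?_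
    · intro j k hk
      have h4 : ((List.finRange i).flatMap fun l =>
          List.replicate (if l = j then k else mult σ l) (B l))
          = ((List.finRange i).flatMap fun l =>
          List.replicate (if l = j then k else mult σ l) l).map B := by
        simp [List.map_flatMap]
      have h5 := hz j k hk
      rw [h4] at h5
      have h6 := hM.isInitialValue h5
      rw [prod_map_flatMap_replicate] at h6
      rw [hf, confluentFunctional_blockPoly b hη, hηz, blockPoly, ← h6]
      simp [hk]
    · rw [sum_mult]
      exact (degree_X_pow_le _).trans_lt (by exact_mod_cast r.2)
  rw [hf, sub_eq_zero, act_X_pow, zero_add] at hf0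
  rw [hf0, extend, dif_pos r.2]

end Matrix

end Graphs

/-! ### Uniqueness of solutions -/

section Uniqueness

open Filter Topology Set

variable {𝕜 X : Type*} [RCLike 𝕜] [NormedAddCommGroup X] [NormedSpace 𝕜 X] [NormedSpace ℝ X]

/-- `g` is `N` times differentiable on `[0, ∞)` and `g(0) = g'(0) = ⋯ = g^{(N-1)}(0) = 0`. -/
def IsFlat : ℕ → (ℝ → X) → Prop
  | 0, _ => True
  | N + 1, g => g 0 = 0 ∧ ∃ g', (∀ t, 0 ≤ t → HasDerivWithinAt g (g' t) (Ici 0) t) ∧ IsFlat N g'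

theorem IsFlat.add {N : ℕ} {f g : ℝ → X} (hf : IsFlat N f) (hg : IsFlat N g) :
    IsFlat N fun t => f t + g t := by
  induction N generalizing f g with
  | zero => trivial
  | succ N ih =>
    obtain ⟨hf0, f', hf', hfN⟩ := hf
    obtain ⟨hg0, g', hg', hgN⟩ := hg
    exact ⟨by simp [hf0, hg0], _, fun t ht => (hf' t ht).add (hg' t ht), ih hfN hgN⟩

theorem IsFlat.of_succ {N : ℕ} {g : ℝ → X} (hg : IsFlat (N + 1) g) : IsFlat N g := by
  induction N generalizing g with
  | zero => trivial
  | succ N ih =>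
    obtain ⟨h0, g', hg', h⟩ := hg
    exact ⟨h0, g', hg', ih h⟩

theorem IsFlat.congr {N : ℕ} {f g : ℝ → X} (hf : IsFlat N f) (h : ∀ t, 0 ≤ t → g t = f t) :
    IsFlat N g := by
  cases N with
  | zero => trivial
  | succ N =>
    obtain ⟨h0, f', hf', hN⟩ := hf
    exact ⟨by rw [h 0 le_rfl, h0], f', fun t ht => (hf' t ht).congr h (h t ht), hN⟩

theorem isFlat_of_iteratedDerivWithin {N : ℕ} {f : ℝ → X} (hf : ContDiffOn ℝ N f (Ici 0))
    (h0 : ∀ k < N, iteratedDerivWithin k f (Ici 0) 0 = 0) : IsFlat N f := by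
  induction N generalizing f with
  | zero => trivial
  | succ N ih =>
    refine ⟨by simpa using h0 0 (Nat.succ_pos N), derivWithin f (Ici 0), fun t ht => ?_, ih ?_ ?_⟩
    · exact (hf.differentiableOn (by simp) t ht).hasDerivWithinAt
    · exact hf.derivWithin (uniqueDiffOn_Ici 0) (by norm_cast)
    · intro k hk
      rw [← iteratedDerivWithin_succ']
      exact h0 (k + 1) (by omega)

theorem IsSolution.sub {n : ℕ} {A : Fin n → X →ₗ.[𝕜] X} {x y : Fin n → X} {u w : ℝ → X}
    (hu : IsSolution A x u) (hw : IsSolution A y w) : IsSolution A (x - y) (u - w) where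
  smooth := hu.smooth.sub hw.smooth
  initial k := by
    have hk : ((k : ℕ) : WithTop ℕ∞) ≤ n := by exact_mod_cast k.2.le
    rw [iteratedDerivWithin_sub (mem_Ici.2 le_rfl) (uniqueDiffOn_Ici 0)
      ((hu.smooth.of_le hk) 0 (mem_Ici.2 le_rfl)) ((hw.smooth.of_le hk) 0 (mem_Ici.2 le_rfl)),
      hu.initial, hw.initial, Pi.sub_apply]
  equation := by
    obtain ⟨v, hv0, hv, hvn⟩ := hu.equation
    obtain ⟨v', hv0', hv', hvn'⟩ := hw.equation
    refine ⟨v - v', fun t ht => ?_, fun m t ht => ?_, fun t ht => ?_⟩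
    · simp [hv0 t ht, hv0' t ht]
    · obtain ⟨a, ha, hd⟩ := hv m t ht
      obtain ⟨a', ha', hd'⟩ := hv' m t ht
      refine ⟨a - a', (A m).graph.sub_mem ha ha', (hd.sub hd').congr_deriv ?_⟩
      simp only [Pi.sub_apply]
      abel
    · simp [hvn t ht, hvn' t ht]

variable [IsScalarTower ℝ 𝕜 X]

theorem HasDerivWithinAt.clm_apply_of_tower (S : X →L[𝕜] X) {g : ℝ → X} {g' : X} {s : Set ℝ} {t : ℝ}
    (h : HasDerivWithinAt g g' s t) : HasDerivWithinAt (fun t => S (g t)) (S g') s t :=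
  (S.restrictScalars ℝ).hasFDerivAt.comp_hasDerivWithinAt t h

theorem IsFlat.clm {N : ℕ} {g : ℝ → X} (hg : IsFlat N g) (S : X →L[𝕜] X) :
    IsFlat N fun t => S (g t) := by
  induction N generalizing g with
  | zero => trivial
  | succ N ih =>
    obtain ⟨h0, g', hg', h⟩ := hg
    exact ⟨by simp [h0], _, fun t ht => HasDerivWithinAt.clm_apply_of_tower S (hg' t ht), ih h⟩

/-- The data concern `u` only, and `v m` need not be smooth enough to compute `v m (0)` from them. A
product `P` of `m` resolvents restores the smoothness, and its injectivity returns `v m (0) = 0`. -/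
theorem IsSolution.eq_zero [CompleteSpace X] {J : Type*} {n : ℕ} {B : J → X →ₗ.[𝕜] X} {σ : Fin n → J}
    {T : J → ℝ → X →L[𝕜] X} (hT : ∀ j, IsC0Semigroup (T j)) (hBT : ∀ j, IsGenerator (B j) (T j))
    {c : J → ℝ} {ρ : J → X →L[𝕜] X} (hρ : ∀ j x y, (x, y) ∈ (B j).graph ↔ ρ j (c j • x - y) = x)
    (hcomm : ∀ j l, (ρ j).comp (ρ l) = (ρ l).comp (ρ j)) {u : ℝ → X}
    (hu : IsSolution (fun m => B (σ m)) 0 u) {t : ℝ} (ht : 0 ≤ t) : u t = 0 := by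
  obtain ⟨v, hv0, hv, hvn⟩ := hu.equation
  have hρ0 : ∀ j (w : X), ρ j w = 0 → w = 0 := by
    intro j w hw
    have h1 : ((0 : X), -w) ∈ (B j).graph := by
      rw [hρ]; simpa using hw
    simpa using (B j).graph_fst_eq_zero_snd h1 rfl
  have flat : ∀ m (hm : m < n + 1), ∃ P : X →L[𝕜] X, (∀ w, P w = 0 → w = 0) ∧
      (∀ l, P.comp (ρ l) = (ρ l).comp P) ∧ IsFlat (n - m) fun t => P (v ⟨m, hm⟩ t) := by
    intro m
    induction m with
    | zero =>
      intro hm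
      refine ⟨1, fun w hw => hw, fun l => rfl, ?_⟩
      exact (isFlat_of_iteratedDerivWithin hu.smooth fun k hk => hu.initial ⟨k, hk⟩).congr hv0
    | succ m ih =>
      intro hm
      obtain ⟨P, hP0, hPρ, hflat⟩ := ih (by omega)
      have hPρ' : ∀ l w, P (ρ l w) = ρ l (P w) := fun l w => congrArg (fun F => F w) (hPρ l)
      set m' : Fin n := ⟨m, by omega⟩
      set R := ρ (σ m')
      refine ⟨P.comp R, fun w hw => hρ0 _ _ (hP0 _ hw), fun l => ?_, ?_⟩
      · rw [ContinuousLinearMap.comp_assoc, hcomm, ← ContinuousLinearMap.comp_assoc, hPρ,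
          ContinuousLinearMap.comp_assoc]
      rw [show n - m = n - (m + 1) + 1 by omega] at hflat
      have hflat' := hflat.of_succ
      obtain ⟨h0, g', hg', hN⟩ := hflat
      -- With `R = (c - A)⁻¹`, the relation `v_{m+1} = v_m' - A v_m` becomes `R v_{m+1} = R v_m' +
      -- v_m - c R v_m`, free of unbounded operators and costing one derivative.
      refine ((hN.clm R).add (hflat'.clm (1 - (c (σ m') : 𝕜) • R))).congr fun t ht => ?_
      obtain ⟨a, ha, hd⟩ := hv m' t ht
      have h1 := HasDerivWithinAt.clm_apply_of_tower P hd
      have h2 : g' t = P (a + v m'.succ t) :=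
        (uniqueDiffOn_Ici (0 : ℝ) t ht).eq_deriv _ (hg' t ht) h1
      have h3 := (hρ _ _ _).1 ha
      change P (R (v m'.succ t)) = R (g' t) + (P (v m'.castSucc t) - (c (σ m') : 𝕜) • R (P (v m'.castSucc t)))
      rw [h2, ← hPρ', ← hPρ', ← map_smul, ← map_sub, ← map_add]
      congr 1
      rw [map_sub, ContinuousLinearMap.map_smul_of_tower, RCLike.real_smul_eq_coe_smul (K := 𝕜)] at h3
      conv_rhs => enter [2, 1]; rw [← h3]
      rw [map_add]
      abel
  have hinit : ∀ m : Fin n, v m.castSucc 0 = 0 := by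
    intro m
    obtain ⟨P, hP0, -, hflat⟩ := flat m (m.2.trans (Nat.lt_succ_self n))
    rw [show n - m = n - m - 1 + 1 by omega] at hflat
    exact hP0 _ hflat.1
  have hall : ∀ m : Fin (n + 1), ∀ t, 0 ≤ t → v m t = 0 := by
    intro m
    induction m using Fin.reverseInduction with
    | last => exact hvn
    | cast m ih =>
      intro t ht
      refine (hBT (σ m)).eq_zero_of_hasDerivWithinAt (hT _) (hinit m) (fun s hs => ?_) ht
      obtain ⟨a, ha, hd⟩ := hv m s hs
      rw [ih s hs, add_zero] at hd
      exact ⟨a, ha, hd⟩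
  rw [← hv0 t ht, hall 0 t ht]

end Uniqueness

/-! ### The differential equation on the level of coefficients -/

section TotalExtension

variable {𝕜 X : Type*} [Field 𝕜] [AddCommGroup X] [Module 𝕜 X]

open scoped Classical in
/-- The extension by zero of an operator to the whole space. -/
def totalOp (A : X →ₗ.[𝕜] X) (x : X) : X := if h : x ∈ A.domain then A ⟨x, h⟩ else 0

theorem mem_graph_totalOp {A : X →ₗ.[𝕜] X} {x : X} (h : x ∈ A.domain) :
    (x, totalOp A x) ∈ A.graph := by
  rw [totalOp, dif_pos h]
  exact A.mem_graph ⟨x, h⟩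

theorem totalOp_zero (A : X →ₗ.[𝕜] X) : totalOp A 0 = 0 :=
  A.graph_fst_eq_zero_snd (mem_graph_totalOp A.domain.zero_mem) rfl

theorem mem_graph_totalOp_of_commonDomain {i : ℕ} {B : Fin i → X →ₗ.[𝕜] X} {N : ℕ} {x : X}
    (hx : x ∈ commonDomain B (N + 1)) (j : Fin i) : (x, totalOp (B j) x) ∈ (B j).graph := by
  obtain ⟨y, -, h⟩ := hx j
  exact mem_graph_totalOp (LinearPMap.mem_domain_of_mem_graph h)

theorem totalOp_mem_commonDomain {i : ℕ} {B : Fin i → X →ₗ.[𝕜] X} {N : ℕ} {x : X}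
    (hx : x ∈ commonDomain B (N + 1)) (j : Fin i) : totalOp (B j) x ∈ commonDomain B N := by
  obtain ⟨y, hy, h⟩ := hx j
  rwa [LinearPMap.mem_graph_snd_inj _ (mem_graph_totalOp_of_commonDomain hx j) h rfl]

/-- The effect of `d/dt` on the coefficients `W j k` of `∑ (t ^ k / k!) T_j(t) (W j k)`. -/
def coeffDeriv {i : ℕ} (B : Fin i → X →ₗ.[𝕜] X) (W : Fin i → ℕ → X) : Fin i → ℕ → X :=
  fun j k => W j (k + 1) + totalOp (B j) (W j k)

/-- The effect of `d/dt - B l` on the coefficients. -/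
def coeffStep {i : ℕ} (B : Fin i → X →ₗ.[𝕜] X) (l : Fin i) (W : Fin i → ℕ → X) : Fin i → ℕ → X :=
  fun j k => coeffDeriv B W j k - totalOp (B l) (W j k)

/-- The coefficients `W j k` vanish for `k ≥ S j` and lie in the common domain of order `N`. -/
structure IsAdmissible {i : ℕ} (B : Fin i → X →ₗ.[𝕜] X) (S : Fin i → ℕ) (N : ℕ) (W : Fin i → ℕ → X) :
    Prop where
  eq_zero : ∀ j k, S j ≤ k → W j k = 0
  mem : ∀ j k, W j k ∈ commonDomain B N

variable {i : ℕ} {B : Fin i → X →ₗ.[𝕜] X} {S : Fin i → ℕ} {N : ℕ} {W : Fin i → ℕ → X}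

theorem IsAdmissible.coeffDeriv (h : IsAdmissible B S (N + 1) W) :
    IsAdmissible B S N (coeffDeriv B W) where
  eq_zero j k hk := by
    rw [DAlembert.coeffDeriv, h.eq_zero j k hk, h.eq_zero j (k + 1) (by omega), totalOp_zero, add_zero]
  mem j k := (commonDomainSubgroup B N).add_mem (commonDomain_succ_subset B N (h.mem j (k + 1)))
    (totalOp_mem_commonDomain (h.mem j k) j)

theorem IsAdmissible.coeffStep (h : IsAdmissible B S (N + 1) W) (l : Fin i) :
    IsAdmissible B S N (coeffStep B l W) where
  eq_zero j k hk := by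
    rw [DAlembert.coeffStep, h.coeffDeriv.eq_zero j k hk, h.eq_zero j k hk, totalOp_zero, sub_zero]
  mem j k := (commonDomainSubgroup B N).sub_mem (h.coeffDeriv.mem j k)
    (totalOp_mem_commonDomain (h.mem j k) l)

theorem IsAdmissible.iterate_coeffDeriv (hW : IsAdmissible B S N W) {r : ℕ} (hr : r ≤ N) :
    IsAdmissible B S (N - r) ((DAlembert.coeffDeriv B)^[r] W) := by
  induction r with
  | zero => exact hW
  | succ r ih =>
    have h := ih (by omega)
    rw [show N - r = N - (r + 1) + 1 by omega] at h
    rw [Function.iterate_succ_apply']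
    exact h.coeffDeriv

section Model

variable {R V : Type*} [CommRing R] [AddCommGroup V] [Module R V] {ι : X →+ V} {b : Fin i → R}

theorem IsModel.map_coeffDeriv (hM : IsModel B ι b) (h : IsAdmissible B S (N + 1) W) (j : Fin i) :
    (fun k => ι (coeffDeriv B W j k))
      = act (Polynomial.X + Polynomial.C (b j)) fun k => ι (W j k) := by
  funext k
  rw [act_X_add_C, coeffDeriv, map_add,
    ← (hM.mem_graph_iff _ _ _).1 (mem_graph_totalOp_of_commonDomain (h.mem j k) j)]

/-- In block `j` the factor `d/dt - B l` is the shift plus `b j - b l`, hence the bare shift when `l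
= j`. -/
theorem IsModel.map_coeffStep (hM : IsModel B ι b) (h : IsAdmissible B S (N + 1) W) (l j : Fin i) :
    (fun k => ι (coeffStep B l W j k))
      = act (Polynomial.X + Polynomial.C (b j - b l)) fun k => ι (W j k) := by
  funext k
  rw [act_X_add_C, coeffStep, coeffDeriv, map_sub, map_add,
    ← (hM.mem_graph_iff _ _ _).1 (mem_graph_totalOp_of_commonDomain (h.mem j k) j),
    ← (hM.mem_graph_iff _ _ _).1 (mem_graph_totalOp_of_commonDomain (h.mem j k) l), sub_smul]
  abel

theorem IsModel.map_iterate_coeffDeriv (hM : IsModel B ι b) (hW : IsAdmissible B S N W) {r : ℕ} (hr : r ≤ N)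
    (j : Fin i) : (fun k => ι ((coeffDeriv B)^[r] W j k))
      = act ((Polynomial.X + Polynomial.C (b j)) ^ r) fun k => ι (W j k) := by
  induction r with
  | zero => simp
  | succ r ih =>
    have h := hW.iterate_coeffDeriv (r := r) (by omega)
    rw [show N - r = N - (r + 1) + 1 by omega] at h
    rw [Function.iterate_succ_apply', hM.map_coeffDeriv h, ih (by omega), ← act_mul, ← pow_succ']

end Model

section Factorisation

variable {n : ℕ} {σ : Fin n → Fin i}

theorem isAdmissible_coeffSeq {y : Coeff σ → X} (hy : ∀ c, y c ∈ commonDomain B n) :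
    IsAdmissible B (mult σ) n (coeffSeq y) where
  eq_zero j _ hk := coeffSeq_of_le y j hk
  mem j k := by
    unfold coeffSeq
    split_ifs
    · exact hy _
    · exact commonDomain_zero_mem B n

/-- The coefficients of `∏_{l < m} (d/dt - B (σ l)) u`. -/
def iteratedStep (B : Fin i → X →ₗ.[𝕜] X) (σ : Fin n → Fin i) (W : Fin i → ℕ → X) (m : ℕ) :
    Fin i → ℕ → X :=
  m.rec W fun m W' => if h : m < n then coeffStep B (σ ⟨m, h⟩) W' else W'

theorem iteratedStep_succ (W : Fin i → ℕ → X) (m : Fin n) :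
    iteratedStep B σ W (m + 1) = coeffStep B (σ m) (iteratedStep B σ W m) := dif_pos m.2

theorem IsAdmissible.iteratedStep {S : Fin i → ℕ} {W : Fin i → ℕ → X} (hW : IsAdmissible B S n W)
    {m : ℕ} (hm : m ≤ n) : IsAdmissible B S (n - m) (iteratedStep B σ W m) := by
  induction m with
  | zero => exact hW
  | succ m ih =>
    have h := ih (by omega)
    rw [show n - m = n - (m + 1) + 1 by omega] at h
    rw [iteratedStep_succ W ⟨m, hm⟩]
    exact h.coeffStep _

theorem IsModel.map_iteratedStep {R V : Type*} [CommRing R] [AddCommGroup V] [Module R V]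
    {ι : X →+ V} {b : Fin i → R} (hM : IsModel B ι b) {S : Fin i → ℕ} {W : Fin i → ℕ → X}
    (hW : IsAdmissible B S n W) {m : ℕ} (hm : m ≤ n) (j : Fin i) :
    (fun k => ι (iteratedStep B σ W m j k))
      = act (∏ l : Fin m, (Polynomial.X + Polynomial.C (b j - b (σ (Fin.castLE hm l)))))
        fun k => ι (W j k) := by
  induction m with
  | zero => simp [iteratedStep]
  | succ m ih =>
    have h := hW.iteratedStep (σ := σ) (m := m) (by omega)
    rw [show n - m = n - (m + 1) + 1 by omega] at h
    rw [iteratedStep_succ W ⟨m, hm⟩, hM.map_coeffStep h, ih (by omega), ← act_mul,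
      Fin.prod_univ_castSucc, mul_comm]
    rfl

/-- The `S j` indices `m` with `σ m = j` each contribute a factor `X`, and `X ^ S j` kills the
coefficients of block `j`, in whatever order the factors are listed. -/
theorem IsModel.iteratedStep_eq_zero {R V : Type*} [CommRing R] [AddCommGroup V] [Module R V]
    {ι : X →+ V} {b : Fin i → R} (hM : IsModel B ι b) {W : Fin i → ℕ → X}
    (hW : IsAdmissible B (mult σ) n W) (j : Fin i) (k : ℕ) : iteratedStep B σ W n j k = 0 := by
  have h1 := congrFun (hM.map_iteratedStep hW le_rfl j (σ := σ)) k
  rw [act_eq_zero_of_dvd (p := Polynomial.X ^ mult σ j)] at h1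
  · exact hM.injective (h1.trans (map_zero ι).symm)
  · refine dvd_trans (dvd_of_eq ?_)
      (Finset.prod_dvd_prod_of_subset (Finset.univ.filter fun m => σ m = j) _ _
        (Finset.subset_univ _))
    rw [mult, ← Finset.prod_const]
    refine Finset.prod_congr rfl fun m hm => ?_
    have hm : σ m = j := (Finset.mem_filter.1 hm).2
    simp [hm]
  · rw [act_X_pow_eq_zero_iff]
    intro k hk
    rw [hW.eq_zero j k hk, map_zero]

end Factorisation

end TotalExtension

/-! ### Differentiating the sums `∑ (t ^ k / k!) T_j(t) w_{j,k}` -/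

section BlockSum

open Filter Topology Set

variable {𝕜 X : Type*} [RCLike 𝕜] [NormedAddCommGroup X] [NormedSpace 𝕜 X] [NormedSpace ℝ X]

/-- `∑_{k < S} (t ^ k / k!) T(t) (w k)`. -/
def blockSum (S : ℕ) (T : ℝ → X →L[𝕜] X) (w : ℕ → X) (t : ℝ) : X :=
  ∑ k ∈ Finset.range S, (t ^ k / (k.factorial : ℝ)) • T t (w k)

theorem blockSum_add (S : ℕ) (T : ℝ → X →L[𝕜] X) (w w' : ℕ → X) (t : ℝ) :
    blockSum S T (fun k => w k + w' k) t = blockSum S T w t + blockSum S T w' t := by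
  simp [blockSum, Finset.sum_add_distrib]

theorem blockSum_sub (S : ℕ) (T : ℝ → X →L[𝕜] X) (w w' : ℕ → X) (t : ℝ) :
    blockSum S T (fun k => w k - w' k) t = blockSum S T w t - blockSum S T w' t := by
  simp [blockSum, Finset.sum_sub_distrib, smul_sub]

theorem blockSum_zero_time {S : ℕ} {T : ℝ → X →L[𝕜] X} (hT : IsC0Semigroup T) {w : ℕ → X}
    (hw : ∀ k, S ≤ k → w k = 0) : blockSum S T w 0 = w 0 := by
  rw [blockSum, Finset.sum_eq_single 0]
  · simp [hT.zero]
  · intro k _ hk; simp [hk]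
  · intro h; rw [hw 0 (by simpa using h)]; simp

theorem mem_graph_blockSum [IsScalarTower ℝ 𝕜 X] {S : ℕ} {A : X →ₗ.[𝕜] X} {T : ℝ → X →L[𝕜] X} {t : ℝ}
    (hA : ∀ x y, (x, y) ∈ A.graph → (T t x, T t y) ∈ A.graph) {w w' : ℕ → X}
    (h : ∀ k, (w k, w' k) ∈ A.graph) : (blockSum S T w t, blockSum S T w' t) ∈ A.graph := by
  induction S with
  | zero => exact A.graph.zero_mem
  | succ S ih =>
    simp only [blockSum, Finset.sum_range_succ]
    have h1 : ((t ^ S / (S.factorial : ℝ)) • T t (w S), (t ^ S / (S.factorial : ℝ)) • T t (w' S))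
        ∈ A.graph := ?_
    · exact A.graph.add_mem ih h1
    rw [RCLike.real_smul_eq_coe_smul (K := 𝕜), RCLike.real_smul_eq_coe_smul (K := 𝕜)]
    exact A.graph.smul_mem _ (hA _ _ (h S))

theorem continuousOn_blockSum [CompleteSpace X] (S : ℕ) {T : ℝ → X →L[𝕜] X} (hT : IsC0Semigroup T)
    (w : ℕ → X) : ContinuousOn (blockSum S T w) (Ici 0) :=
  continuousOn_finsetSum _ fun k _ =>
    (by fun_prop : Continuous fun t : ℝ => t ^ k / (k.factorial : ℝ)).continuousOn.smul
      (hT.continuousOn _)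

theorem hasDerivWithinAt_blockSum [IsScalarTower ℝ 𝕜 X] [CompleteSpace X] {S : ℕ} {A : X →ₗ.[𝕜] X}
    {T : ℝ → X →L[𝕜] X} (hA : IsGenerator A T) (hT : IsC0Semigroup T) {w w' : ℕ → X} (hS : w S = 0)
    (h : ∀ k, (w k, w' k) ∈ A.graph) {t : ℝ} (ht : 0 ≤ t) :
    HasDerivWithinAt (blockSum S T w) (blockSum S T (fun k => w (k + 1) + w' k) t) (Ici 0) t := by
  have hterm : ∀ k ∈ Finset.range S, HasDerivWithinAt
      (fun t : ℝ => (t ^ k / (k.factorial : ℝ)) • T t (w k))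
      ((t ^ k / (k.factorial : ℝ)) • T t (w' k) + ((k * t ^ (k - 1)) / (k.factorial : ℝ)) • T t (w k))
      (Ici 0) t := fun k _ =>
    (((hasDerivAt_pow k t).div_const _).hasDerivWithinAt).smul (hA.hasDerivWithinAt hT (h k) ht)
  refine (HasDerivWithinAt.fun_sum hterm).congr_deriv ?_
  rw [blockSum_add, Finset.sum_add_distrib, add_comm]
  congr 1
  -- The added term `k = S` vanishes because `w S = 0`; reindexing then turns differentiation of `t
  -- ^ k / k!` into the shift of `w`.
  have h1 : ∑ k ∈ Finset.range S, ((k * t ^ (k - 1)) / (k.factorial : ℝ)) • T t (w k)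
      = ∑ k ∈ Finset.range (S + 1), ((k * t ^ (k - 1)) / (k.factorial : ℝ)) • T t (w k) := by
    rw [Finset.sum_range_succ, hS, map_zero, smul_zero, add_zero]
  rw [h1, Finset.sum_range_succ', blockSum]
  simp only [Nat.cast_zero, zero_mul, zero_div, zero_smul, add_zero, Nat.add_sub_cancel]
  refine Finset.sum_congr rfl fun k _ => ?_
  congr 1
  rw [Nat.factorial_succ, Nat.cast_mul, mul_div_mul_left]
  exact_mod_cast Nat.succ_ne_zero k

/-- `∑_j ∑_{k < S_j} (t ^ k / k!) T_j(t) (W j k)`. -/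
def blocksSum {i : ℕ} (S : Fin i → ℕ) (T : Fin i → ℝ → X →L[𝕜] X) (W : Fin i → ℕ → X) (t : ℝ) : X :=
  ∑ j, blockSum (S j) (T j) (W j) t

variable {i : ℕ} {B : Fin i → X →ₗ.[𝕜] X} {S : Fin i → ℕ} {N : ℕ} {W : Fin i → ℕ → X}
  {T : Fin i → ℝ → X →L[𝕜] X}

theorem continuousOn_blocksSum [CompleteSpace X] (S : Fin i → ℕ) (hT : ∀ j, IsC0Semigroup (T j))
    (W : Fin i → ℕ → X) : ContinuousOn (blocksSum S T W) (Ici 0) :=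
  continuousOn_finsetSum _ fun j _ => continuousOn_blockSum _ (hT j) _

variable [IsScalarTower ℝ 𝕜 X]

theorem hasDerivWithinAt_blocksSum [CompleteSpace X] (hT : ∀ j, IsC0Semigroup (T j))
    (hBT : ∀ j, IsGenerator (B j) (T j)) (hW : IsAdmissible B S (N + 1) W) {t : ℝ} (ht : 0 ≤ t) :
    HasDerivWithinAt (blocksSum S T W) (blocksSum S T (coeffDeriv B W) t) (Ici 0) t :=
  HasDerivWithinAt.fun_sum fun j _ => hasDerivWithinAt_blockSum (hBT j) (hT j)
    (hW.eq_zero j _ le_rfl) (fun k => mem_graph_totalOp_of_commonDomain (hW.mem j k) j) ht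

/-- Because the semigroups commute, `T j t` preserves the graph of every `B l`, so `B l` can be
applied to the sum coefficientwise. -/
theorem exists_mem_graph_blocksSum (hBT : ∀ j, IsGenerator (B j) (T j))
    (hcomm : ∀ (j k : Fin i) (t s : ℝ), 0 ≤ t → 0 ≤ s →
      (T j t).comp (T k s) = (T k s).comp (T j t))
    (hW : IsAdmissible B S (N + 1) W) (l : Fin i) {t : ℝ} (ht : 0 ≤ t) :
    ∃ a, (blocksSum S T W t, a) ∈ (B l).graph ∧
      blocksSum S T (coeffDeriv B W) t = a + blocksSum S T (coeffStep B l W) t := by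
  have h1 : ∀ j, (blockSum (S j) (T j) (W j) t,
      blockSum (S j) (T j) (fun k => totalOp (B l) (W j k)) t) ∈ (B l).graph := fun j =>
    mem_graph_blockSum (fun x y hxy => (hBT l).graph_map (fun s hs => hcomm j l t s ht hs) hxy)
      fun k => mem_graph_totalOp_of_commonDomain (hW.mem j k) l
  refine ⟨∑ j, blockSum (S j) (T j) (fun k => totalOp (B l) (W j k)) t, ?_, ?_⟩
  · have := (B l).graph.sum_mem fun j (_ : j ∈ Finset.univ) => h1 j
    rwa [show ∀ f g : Fin i → X, ∑ j, (f j, g j) = (∑ j, f j, ∑ j, g j) from fun f g =>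
      Prod.ext Prod.fst_sum Prod.snd_sum] at this
  · simp only [blocksSum, ← Finset.sum_add_distrib]
    refine Finset.sum_congr rfl fun j _ => ?_
    rw [show coeffStep B l W j = fun k => coeffDeriv B W j k - totalOp (B l) (W j k) from rfl,
      blockSum_sub, add_sub_cancel]

theorem iteratedDerivWithin_blocksSum [CompleteSpace X] (hT : ∀ j, IsC0Semigroup (T j))
    (hBT : ∀ j, IsGenerator (B j) (T j)) (hW : IsAdmissible B S N W) {r : ℕ} (hr : r ≤ N) {t : ℝ}
    (ht : 0 ≤ t) : iteratedDerivWithin r (blocksSum S T W) (Ici 0) t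
      = blocksSum S T ((coeffDeriv B)^[r] W) t := by
  induction r generalizing t with
  | zero => simp
  | succ r ih =>
    have h := hW.iterate_coeffDeriv (r := r) (by omega)
    rw [show N - r = N - (r + 1) + 1 by omega] at h
    rw [iteratedDerivWithin_succ, Function.iterate_succ_apply']
    exact ((hasDerivWithinAt_blocksSum hT hBT h ht).congr (fun s hs => ih (by omega) hs)
      (ih (by omega) ht)).derivWithin (uniqueDiffOn_Ici (0 : ℝ) t ht)

theorem contDiffOn_blocksSum [CompleteSpace X] (hT : ∀ j, IsC0Semigroup (T j))
    (hBT : ∀ j, IsGenerator (B j) (T j)) (hW : IsAdmissible B S N W) :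
    ContDiffOn ℝ N (blocksSum S T W) (Ici 0) := by
  refine contDiffOn_of_continuousOn_differentiableOn_deriv (n := (N : ℕ∞)) (fun r hr => ?_)
    fun r hr t ht => ?_
  · have hr : r ≤ N := by exact_mod_cast hr
    exact (continuousOn_blocksSum S hT _).congr fun t ht =>
      iteratedDerivWithin_blocksSum hT hBT hW hr ht
  · have hr : r < N := by exact_mod_cast hr
    have h := hW.iterate_coeffDeriv hr.le
    rw [show N - r = N - (r + 1) + 1 by omega] at h
    exact ((hasDerivWithinAt_blocksSum hT hBT h ht).congr
      (fun s hs => iteratedDerivWithin_blocksSum hT hBT hW hr.le hs)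
      (iteratedDerivWithin_blocksSum hT hBT hW hr.le ht)).differentiableWithinAt

end BlockSum

/-! ### The formula solves the problem -/

section Existence

open Filter Topology Set

variable {𝕜 X : Type*} [RCLike 𝕜] [NormedAddCommGroup X] [NormedSpace 𝕜 X] [NormedSpace ℝ X]
  {n i : ℕ} {σ : Fin n → Fin i} {B : Fin i → X →ₗ.[𝕜] X} {T : Fin i → ℝ → X →L[𝕜] X}

theorem dAlembert_eq_blocksSum (y : Coeff σ → X) :
    dAlembert σ T y = blocksSum (mult σ) T (coeffSeq y) := by
  funext t
  refine Finset.sum_congr rfl fun j _ => ?_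
  rw [blockSum, ← Fin.sum_univ_eq_sum_range fun k => (t ^ k / (k.factorial : ℝ)) • T j t (coeffSeq y j k)]
  exact Finset.sum_congr rfl fun k _ => by rw [coeffSeq_coe]

theorem IsModel.isSolution_dAlembert {R V : Type*} [CommRing R] [AddCommGroup V] [Module R V]
    [IsScalarTower ℝ 𝕜 X] [CompleteSpace X]
    {ι : X →+ V} {b : Fin i → R} (hM : IsModel B ι b) (hT : ∀ j, IsC0Semigroup (T j))
    (hBT : ∀ j, IsGenerator (B j) (T j))
    (hcomm : ∀ (j k : Fin i) (t s : ℝ), 0 ≤ t → 0 ≤ s →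
      (T j t).comp (T k s) = (T k s).comp (T j t))
    {y : Coeff σ → X} (hy : ∀ c, y c ∈ commonDomain B n) :
    IsSolution (fun m => B (σ m)) (matrixM σ B ⟨y, mem_domain_matrixM hy⟩) (dAlembert σ T y) := by
  have hW := isAdmissible_coeffSeq hy
  rw [dAlembert_eq_blocksSum]
  refine ⟨contDiffOn_blocksSum hT hBT hW, fun r => hM.injective ?_, ?_⟩
  · rw [hM.map_matrixM, iteratedDerivWithin_blocksSum hT hBT hW r.2.le le_rfl,
      confluentFunctional_apply, blocksSum, map_sum]
    refine Finset.sum_congr rfl fun j _ => ?_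
    have hWr := hW.iterate_coeffDeriv (r := r) r.2.le
    rw [blockSum_zero_time (hT j) (hWr.eq_zero j)]
    have hX : Polynomial.taylorAlgHom (b j) Polynomial.X = Polynomial.X + Polynomial.C (b j) := by
      simp
    rw [map_pow, hX]
    exact congrFun (hM.map_iterate_coeffDeriv hW r.2.le j) 0
  · refine ⟨fun m => blocksSum (mult σ) T (iteratedStep B σ (coeffSeq y) m), fun t _ => rfl,
      fun m t ht => ?_, fun t _ => ?_⟩
    · have h := hW.iteratedStep (σ := σ) (m := m) m.2.le
      rw [show n - (m : ℕ) = n - (m + 1) + 1 by omega] at h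
      obtain ⟨a, ha, hd⟩ := exists_mem_graph_blocksSum hBT hcomm h (σ m) ht
      refine ⟨a, ha, ?_⟩
      simp only [Fin.val_succ, iteratedStep_succ, ← hd]
      exact hasDerivWithinAt_blocksSum hT hBT h ht
    · simp [blocksSum, blockSum, hM.iteratedStep_eq_zero hW]

end Existence

end DAlembert

end

theorem theorem1 {𝕜 X : Type*} [RCLike 𝕜] [NormedAddCommGroup X] [NormedSpace 𝕜 X]
    [NormedSpace ℝ X] [IsScalarTower ℝ 𝕜 X] [CompleteSpace X]
    (n i : ℕ) (A : Fin n → X →ₗ.[𝕜] X) (B : Fin i → X →ₗ.[𝕜] X) (σ : Fin n → Fin i)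
    (hσ : Function.Surjective σ) (hAB : ∀ m, A m = B (σ m)) (hB : Function.Injective B)
    (T : Fin i → ℝ → X →L[𝕜] X) (hT : ∀ j, DAlembert.IsC0Semigroup (T j))
    (hBT : ∀ j, DAlembert.IsGenerator (B j) (T j))
    (hcomm : ∀ (j k : Fin i) (t s : ℝ), 0 ≤ t → 0 ≤ s →
      (T j t).comp (T k s) = (T k s).comp (T j t))
    (hinj : ∀ j k, j ≠ k → Function.Injective (B j - B k)) :
    Function.Injective (DAlembert.matrixM σ B) ∧
    (∀ x : Fin n → X, DAlembert.RangeLargeEnough σ B x →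
      ∃ y : DAlembert.Coeff σ → X, (∀ c, y c ∈ DAlembert.commonDomain B n) ∧
        (y, x) ∈ (DAlembert.matrixM σ B).graph) ∧
    (∀ x : Fin n → X,
      (∃ y : DAlembert.Coeff σ → X, (∀ c, y c ∈ DAlembert.commonDomain B n) ∧
        (y, x) ∈ (DAlembert.matrixM σ B).graph) →
      ∃ hx : x ∈ (DAlembert.matrixM σ B).inverse.domain,
        DAlembert.IsSolution A x
          (DAlembert.dAlembert σ T ((DAlembert.matrixM σ B).inverse ⟨x, hx⟩)) ∧
        ∀ u : ℝ → X, DAlembert.IsSolution A x u → ∀ t, 0 ≤ t →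
          u t = DAlembert.dAlembert σ T ((DAlembert.matrixM σ B).inverse ⟨x, hx⟩) t) := by
  obtain ⟨c, ρ, hρ, hρcomm⟩ := DAlembert.exists_commuting_resolvents hT hBT hcomm
  obtain ⟨R, V, _, _, _, ι, b, hM⟩ := DAlembert.exists_isModel hρ hρcomm fun j l hjl x y hj hl =>
    DAlembert.eq_of_mem_graph_of_injective_sub (hinj j l hjl) hj hl
  have hMinj : Function.Injective (DAlembert.matrixM σ B) := hM.injective_matrixM
  refine ⟨hMinj, fun x hx => hM.exists_of_rangeLargeEnough hx, ?_⟩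
  rintro x ⟨y, hy, hyx⟩
  have hdom := DAlembert.mem_domain_matrixM (σ := σ) hy
  obtain rfl : DAlembert.matrixM σ B ⟨y, hdom⟩ = x :=
    LinearPMap.mem_graph_snd_inj _ (LinearPMap.mem_graph _ ⟨y, hdom⟩) hyx rfl
  have hker : LinearMap.ker (DAlembert.matrixM σ B).toFun = ⊥ := LinearMap.ker_eq_bot.2 hMinj
  have hx : DAlembert.matrixM σ B ⟨y, hdom⟩ ∈ (DAlembert.matrixM σ B).inverse.domain := by
    rw [LinearPMap.inverse_domain]
    exact ⟨⟨y, hdom⟩, rfl⟩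
  have hinv : (DAlembert.matrixM σ B).inverse ⟨_, hx⟩ = y :=
    LinearPMap.inverse_apply_eq hker (y := ⟨_, hx⟩) (x := ⟨y, hdom⟩) rfl
  obtain rfl : A = fun m => B (σ m) := funext hAB
  have hsol := hM.isSolution_dAlembert hT hBT hcomm hy
  refine ⟨hx, ?_, fun u hu t ht => ?_⟩
  · rw [hinv]; exact hsol
  · rw [hinv]
    -- The difference of two solutions with equal data solves the problem with zero data.
    have hsub := hu.sub hsol
    rw [sub_self] at hsub
    exact sub_eq_zero.1 (hsub.eq_zero hT hBT hρ hρcomm ht)
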